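/- Let $R$ be a commutative noetherian local ring and work in the derived category $\mathcal D(R)$ of complexes of $R$-modules; $\simeq$ denotes isomorphism in $\mathcal D(R)$. A complex $X$ is *homologically bounded* if $\mathrm H_i(X)=0$ for all but finitely many $i\in\mathbb Z$, and *homologically finite* if moreover every $\mathrm H_i(X)$ is a finitely generated $R$-module. For complexes $A,N$: * $A$ is *semidualizing* if it is homologically finite and the homothety morphism $R\to\mathbf R\mathrm{Hom}_R(A,A)$ is an isomorphism in $\mathcal D(R)$. * $N$ is *derived $A$-reflexive* if $N$ and $\mathbf R\mathrm{Hom}_R(N,A)$ are homologically finite and the biduality morphism $N\to\mathbf R\mathrm{Hom}_R(\mathbf R\mathrm{Hom}_R(N,A),A)$ is an isomorphism in $\mathcal D(R)$. * $N$ is in the *Bass class* $\mathcal B_A(R)$ if $N$ and $\mathbf R\mathrm{Hom}_R(A,N)$ are homologically bounded and the evaluation morphism $A\otimes^{\mathbf L}_R\mathbf R\mathrm{Hom}_R(A,N)\to N$ is an isomorphism in $\mathcal D(R)$. * $N$ is in the *Auslander class* $\mathcal A_A(R)$ if $N$ and $A\otimes^{\mathbf L}_RN$ are homologically bounded and the natural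 morphism $N\to\mathbf R\mathrm{Hom}_R(A,A\otimes^{\mathbf L}_RN)$ is an isomorphism in $\mathcal D(R)$. Let $A$ be a homologically finite $R$-complex. Then the following conditions are equivalent: 1. $A$ is semidualizing; 2. $\mathbf R\mathrm{Hom}_R(A,A)$ is semidualizing; 3. $A$ is derived $A$-reflexive and $A\not\simeq 0$; 4. $\mathbf R\mathrm{Hom}_R(A,A)$ is derived $A$-reflexive and $A\not\simeq 0$; 5. $A\in\mathcal B_A(R)$ and $A\not\simeq 0$; 6. $R\in\mathcal A_A(R)$. -/

import Mathlib

universe u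

open CategoryTheory

noncomputable section

namespace DerivedMod

open HomologicalComplex CochainComplex.HomComplex

variable {R : Type u} [CommRing R]

/-! Complexes of `R`-modules are indexed cohomologically: the module written `X_i` in homological
indexing is `X.X (-i)`. -/

/-- The Hom complex `Hom_R(X, Y)` as a complex of `R`-modules: in degree `n` it consists of the
families of `R`-linear maps `X.X p → Y.X (p + n)`, and the differential is
`δ f = d ∘ f - (-1) ^ n • f ∘ d`. -/
def homComplex (X Y : CochainComplex (ModuleCat.{u} R) ℤ) : CochainComplex (ModuleCat.{u} R) ℤ where
  X n := ModuleCat.of R (Cochain X Y n)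
  d i j := ModuleCat.ofHom (δ_hom R X Y i j)
  shape i j hij := ModuleCat.hom_ext (LinearMap.ext fun z => δ_shape i j hij z)
  d_comp_d' i j k _ _ := ModuleCat.hom_ext (LinearMap.ext fun z => δ_δ i j k z)

/-- Evaluation at `x` of a cochain of degree `n`. -/
def evalAt {X Y : CochainComplex (ModuleCat.{u} R) ℤ} {n : ℤ} (f : Cochain X Y n) (p q : ℤ)
    (h : p + n = q) (x : X.X p) : Y.X q :=
  (f.v p q h).hom x

lemma evalAt_δ {X Y : CochainComplex (ModuleCat.{u} R) ℤ} {n m : ℤ} (hnm : n + 1 = m)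
    (f : Cochain X Y n) (p p' q q' : ℤ) (hp : p + 1 = p') (hpq : p + n = q) (hq : p + m = q')
    (x : X.X p) :
    evalAt (δ n m f) p q' hq x =
      (Y.d q q').hom (evalAt f p q hpq x) +
        m.negOnePow • evalAt f p' q' (by lia) ((X.d p p').hom x) := by
  unfold evalAt
  rw [δ_v n m hnm f p q' hq q p' (by lia) hp]
  rfl

/-- Contravariant functoriality of the Hom complex. -/
def homComplexPrecomp {X X' : CochainComplex (ModuleCat.{u} R) ℤ} (f : X' ⟶ X)
    (Y : CochainComplex (ModuleCat.{u} R) ℤ) : homComplex X Y ⟶ homComplex X' Y where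
  f n := ModuleCat.ofHom
    { toFun := fun (z : Cochain X Y n) => (Cochain.ofHom f).comp z (zero_add n)
      map_add' := fun _ _ => Cochain.comp_add _ _ _ _
      map_smul' := fun _ _ => Cochain.comp_smul _ _ _ _ }
  comm' _ j _ := ModuleCat.hom_ext (LinearMap.ext fun z => δ_ofHom_comp f z j)

/-- The natural map `X → Hom(Hom(X, Y), Y)`, `x ↦ (f ↦ (-1) ^ (|x| |f|) f(x))`. -/
def biduality (X Y : CochainComplex (ModuleCat.{u} R) ℤ) :
    X ⟶ homComplex (homComplex X Y) Y where
  f n := ModuleCat.ofHom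
    { toFun := fun (x : X.X n) => Cochain.mk fun p q (hpq : p + n = q) => ModuleCat.ofHom
        { toFun := fun (f : Cochain X Y p) => (n * p).negOnePow • evalAt f n q (by lia) x
          map_add' := fun _ _ => by
            rw [← smul_add]; rfl
          map_smul' := fun _ _ => by
            rw [RingHom.id_apply, smul_comm]; rfl }
      map_add' := fun a b => by
        ext p q hpq f
        change (n * p).negOnePow • (f.v n q _).hom (a + b) = _
        rw [map_add, smul_add]; rfl
      map_smul' := fun r a => by
        ext p q hpq f
        change (n * p).negOnePow • (f.v n q _).hom (r • a) = _
        rw [map_smul, smul_comm]; rfl }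
  comm' n m hnm := by
    obtain rfl : n + 1 = m := hnm
    refine ModuleCat.hom_ext (LinearMap.ext fun x => ?_)
    refine Cochain.ext _ _ fun p q hpq => ?_
    refine ModuleCat.hom_ext (LinearMap.ext fun (f : Cochain X Y p) => ?_)
    obtain rfl : q = n + p + 1 := by lia
    refine (evalAt_δ (X := homComplex X Y) rfl (Cochain.mk fun p q (hpq : p + n = q) => _) p (p + 1)
      (n + p) _ rfl (by lia) hpq f).trans ?_
    change (Y.d _ _).hom ((n * p).negOnePow • evalAt f n (n + p) rfl x) +
      (n + 1).negOnePow • ((n * (p + 1)).negOnePow •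
        evalAt (δ p (p + 1) f) n (n + p + 1) (by lia) x) =
      ((n + 1) * p).negOnePow • evalAt f (n + 1) (n + p + 1) (by lia) ((X.d n (n + 1)).hom x)
    rw [evalAt_δ rfl f n (n + 1) (n + p) (n + p + 1) rfl rfl (by lia)]
    have e1 : (n + 1).negOnePow * (n * (p + 1)).negOnePow = - (n * p).negOnePow := by
      rw [← Int.negOnePow_add, ← Int.negOnePow_succ, Int.negOnePow_eq_iff]
      exact ⟨n, by ring⟩
    have e2 : - (n * p).negOnePow * (p + 1).negOnePow = ((n + 1) * p).negOnePow := by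
      rw [← Int.negOnePow_succ, ← Int.negOnePow_add, Int.negOnePow_eq_iff]
      exact ⟨1, by ring⟩
    rw [smul_smul, e1, smul_add, smul_smul, e2, Units.smul_def, map_zsmul, ← Units.smul_def,
      Units.neg_smul, add_neg_cancel_left]

/-- The element `x ⊗ y` of the tensor product of two complexes. -/
def tmul {X Y : CochainComplex (ModuleCat.{u} R) ℤ} {p q n : ℤ} (h : p + q = n) (x : X.X p)
    (y : Y.X q) : (tensorObj X Y).X n :=
  (ιTensorObj X Y p q n h).hom (TensorProduct.tmul R x y)

lemma tmul_add {X Y : CochainComplex (ModuleCat.{u} R) ℤ} {p q n : ℤ} (h : p + q = n) (x : X.X p)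
    (y y' : Y.X q) : (tmul h x (y + y') : (tensorObj X Y).X n) = tmul h x y + tmul h x y' :=
  (congrArg (ιTensorObj X Y p q n h).hom (TensorProduct.tmul_add x y y')).trans (map_add _ _ _)

lemma add_tmul {X Y : CochainComplex (ModuleCat.{u} R) ℤ} {p q n : ℤ} (h : p + q = n)
    (x x' : X.X p) (y : Y.X q) :
    (tmul h (x + x') y : (tensorObj X Y).X n) = tmul h x y + tmul h x' y :=
  (congrArg (ιTensorObj X Y p q n h).hom (TensorProduct.add_tmul x x' y)).trans (map_add _ _ _)

lemma tmul_smul {X Y : CochainComplex (ModuleCat.{u} R) ℤ} {p q n : ℤ} (h : p + q = n) (r : R)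
    (x : X.X p) (y : Y.X q) : (tmul h x (r • y) : (tensorObj X Y).X n) = r • tmul h x y :=
  (congrArg (ιTensorObj X Y p q n h).hom (TensorProduct.tmul_smul r x y)).trans (map_smul _ _ _)

lemma smul_tmul {X Y : CochainComplex (ModuleCat.{u} R) ℤ} {p q n : ℤ} (h : p + q = n) (r : R)
    (x : X.X p) (y : Y.X q) : (tmul h (r • x) y : (tensorObj X Y).X n) = r • tmul h x y :=
  (congrArg (ιTensorObj X Y p q n h).hom (TensorProduct.smul_tmul' r x y).symm).trans
    (map_smul _ _ _)

lemma d_tmul {X Y : CochainComplex (ModuleCat.{u} R) ℤ} {p q n m p' q' : ℤ} (h : p + q = n)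
    (hp : p + 1 = p') (hq : q + 1 = q') (hm : n + 1 = m) (x : X.X p) (y : Y.X q) :
    ((tensorObj X Y).d n m).hom (tmul h x y) =
      tmul (by lia) ((X.d p p').hom x) y + p.negOnePow • tmul (by lia) x ((Y.d q q').hom y) := by
  have key : ιTensorObj X Y p q n h ≫ (tensorObj X Y).d n m =
      (MonoidalCategory.whiskerRight (X.d p p') (Y.X q)) ≫ ιTensorObj X Y p' q m (by lia) +
      p.negOnePow • (MonoidalCategory.whiskerLeft (X.X p) (Y.d q q')) ≫
        ιTensorObj X Y p q' m (by lia) := by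
    rw [mapBifunctor.d_eq, Preadditive.comp_add, mapBifunctor.ι_D₁, mapBifunctor.ι_D₂,
      mapBifunctor.d₁_eq _ _ _ _ hp _ _ (show p' + q = m by lia),
      mapBifunctor.d₂_eq _ _ _ _ _ hq _ (show p + q' = m by lia)]
    simp
  exact congrArg (fun f => f.hom (TensorProduct.tmul R x y)) key

/-- The natural evaluation map on components. -/
def evaluationAux (X Y : CochainComplex (ModuleCat.{u} R) ℤ) (p q n : ℤ) (h : p + q = n) :
    MonoidalCategoryStruct.tensorObj (X.X p) ((homComplex X Y).X q) ⟶ Y.X n :=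
  ModuleCat.MonoidalCategory.tensorLift
    (fun (x : X.X p) (f : Cochain X Y q) => (p * q).negOnePow • evalAt f p n h x)
    (fun a b f => by
      change _ • (f.v p n h).hom (a + b) = _
      rw [map_add, smul_add]; rfl)
    (fun r a f => by
      change _ • (f.v p n h).hom (r • a) = _
      rw [map_smul, smul_comm]; rfl)
    (fun _ _ _ => by
      rw [← smul_add]; rfl)
    (fun _ _ _ => by
      rw [smul_comm]; rfl)

/-- The natural evaluation map `X ⊗ Hom(X, Y) → Y`, `x ⊗ f ↦ (-1) ^ (|x| |f|) f(x)`. -/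
def evaluation (X Y : CochainComplex (ModuleCat.{u} R) ℤ) :
    tensorObj X (homComplex X Y) ⟶ Y where
  f n := mapBifunctorDesc fun p q (h : p + q = n) => evaluationAux X Y p q n h
  comm' n m hnm := by
    obtain rfl : n + 1 = m := hnm
    refine mapBifunctor.hom_ext fun p q h => ?_
    replace h : p + q = n := h
    have key (p q n : ℤ) (h : p + q = n) (x : X.X p) (f : Cochain X Y q) :
        (mapBifunctorDesc (K₁ := X) (K₂ := homComplex X Y) (c := ComplexShape.up ℤ)
          (F := MonoidalCategory.curriedTensor _)
          fun p q (h : p + q = n) => evaluationAux X Y p q n h).hom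
          (tmul (Y := homComplex X Y) h x f) = (p * q).negOnePow • evalAt f p n h x :=
      congrArg (fun g => g.hom (TensorProduct.tmul R x f))
        (ι_mapBifunctorDesc (K₁ := X) (K₂ := homComplex X Y) (c := ComplexShape.up ℤ)
          (F := MonoidalCategory.curriedTensor _)
          (fun p q (h : p + q = n) => evaluationAux X Y p q n h) p q h)
    refine ModuleCat.hom_ext (TensorProduct.ext' fun x (f : Cochain X Y q) => ?_)
    refine Eq.trans (congrArg (Y.d n (n + 1)).hom (key p q n h x f)) ?_
    refine Eq.trans ?_ (congrArg (ModuleCat.Hom.hom _)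
      (d_tmul (Y := homComplex X Y) h rfl rfl rfl x f)).symm
    rw [map_add, Units.smul_def p.negOnePow, map_zsmul, ← Units.smul_def, key]
    refine Eq.trans ?_ (congrArg (fun z => _ + p.negOnePow • z)
      (key p (q + 1) (n + 1) (by lia) x (δ q (q + 1) f))).symm
    rw [evalAt_δ rfl f p (p + 1) n (n + 1) rfl h (by lia), Units.smul_def, map_zsmul,
      ← Units.smul_def, smul_smul, smul_add, smul_smul]
    have e1 : p.negOnePow * (p * (q + 1)).negOnePow = (p * q).negOnePow := by
      rw [← Int.negOnePow_add, Int.negOnePow_eq_iff]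
      exact ⟨p, by ring⟩
    have e2 : (p * q).negOnePow * (q + 1).negOnePow = - ((p + 1) * q).negOnePow := by
      rw [← Int.negOnePow_add, ← Int.negOnePow_succ, Int.negOnePow_eq_iff]
      exact ⟨0, by ring⟩
    rw [e1, e2, Units.neg_smul]
    abel

lemma units_smul_comm (M : ModuleCat.{u} R) (e : ℤˣ) (r : R) (m : M) :
    e • r • m = r • e • m := smul_comm e r m

/-- The cochain `x ↦ (-1) ^ (|x| |y|) x ⊗ y` attached to an element `y` of degree `n`. -/
def coevaluationAux {X Y : CochainComplex (ModuleCat.{u} R) ℤ} {n : ℤ} (y : Y.X n) :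
    Cochain X (tensorObj X Y) n :=
  Cochain.mk fun p q (hpq : p + n = q) => ModuleCat.ofHom
    { toFun := fun (x : X.X p) => (n * p).negOnePow • (tmul hpq x y : (tensorObj X Y).X q)
      map_add' := fun a b => (congrArg _ (add_tmul hpq a b y)).trans (smul_add _ _ _)
      map_smul' := fun r a => (congrArg _ (smul_tmul hpq r a y)).trans
        (units_smul_comm ((tensorObj X Y).X q) _ r _) }

lemma evalAt_coevaluationAux {X Y : CochainComplex (ModuleCat.{u} R) ℤ} {n : ℤ} (y : Y.X n)
    (p q : ℤ) (hpq : p + n = q) (x : X.X p) :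
    evalAt (coevaluationAux y) p q hpq x =
      (n * p).negOnePow • (tmul hpq x y : (tensorObj X Y).X q) := rfl

lemma cochain_ext {X Y : CochainComplex (ModuleCat.{u} R) ℤ} {n : ℤ} {f g : Cochain X Y n}
    (h : ∀ (p q : ℤ) (hpq : p + n = q) (x : X.X p), evalAt f p q hpq x = evalAt g p q hpq x) :
    f = g :=
  Cochain.ext _ _ fun p q hpq => ModuleCat.hom_ext (LinearMap.ext fun x => h p q hpq x)

/-- The natural map `Y → Hom(X, X ⊗ Y)`, `y ↦ (x ↦ (-1) ^ (|x| |y|) x ⊗ y)`. -/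
def coevaluation (X Y : CochainComplex (ModuleCat.{u} R) ℤ) :
    Y ⟶ homComplex X (tensorObj X Y) where
  f n := ModuleCat.ofHom
    { toFun := fun (y : Y.X n) => coevaluationAux (X := X) y
      map_add' := fun a b => cochain_ext fun p q hpq x =>
        (congrArg (fun z : (tensorObj X Y).X q => (n * p).negOnePow • z)
          (tmul_add hpq x a b)).trans (smul_add _ _ _)
      map_smul' := fun r a => cochain_ext fun p q hpq x =>
        (congrArg _ (tmul_smul hpq r x a)).trans
          (units_smul_comm ((tensorObj X Y).X q) _ r _) }
  comm' n m hnm := by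
    obtain rfl : n + 1 = m := hnm
    refine ModuleCat.hom_ext (LinearMap.ext fun y => ?_)
    change δ n (n + 1) (coevaluationAux y) = coevaluationAux ((Y.d n (n + 1)).hom y)
    refine cochain_ext fun p q hpq x => ?_
    rw [evalAt_δ rfl _ p (p + 1) (p + n) q rfl rfl hpq, evalAt_coevaluationAux,
      evalAt_coevaluationAux, evalAt_coevaluationAux, Units.smul_def, map_zsmul, ← Units.smul_def,
      d_tmul rfl rfl rfl (by lia), smul_add, smul_smul, smul_smul]
    have e1 : (n + 1).negOnePow * (n * (p + 1)).negOnePow = - (n * p).negOnePow := by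
      rw [← Int.negOnePow_add, ← Int.negOnePow_succ, Int.negOnePow_eq_iff]
      exact ⟨n, by ring⟩
    have e2 : (n * p).negOnePow * p.negOnePow = ((n + 1) * p).negOnePow := by
      rw [← Int.negOnePow_add, add_one_mul]
    rw [e1, e2, Units.neg_smul]
    abel

/-- The ring `R`, viewed as a complex concentrated in degree `0`. -/
abbrev ringComplex (R : Type u) [CommRing R] : CochainComplex (ModuleCat.{u} R) ℤ :=
  (HomologicalComplex.single (ModuleCat.{u} R) (ComplexShape.up ℤ) 0).obj (ModuleCat.of R R)

/-- For a chain map `π : P → X`, the chain map `R → Hom(P, X)`, `r ↦ r • π`. -/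
def homothety {P X : CochainComplex (ModuleCat.{u} R) ℤ} (π : P ⟶ X) :
    ringComplex R ⟶ homComplex P X :=
  mkHomFromSingle (K := homComplex P X) (j := 0)
    (ModuleCat.ofHom (LinearMap.toSpanSingleton R (Cochain P X 0) (Cochain.ofHom π)))
    (fun k _ => ModuleCat.hom_ext <| LinearMap.ext_ring <| by
      change δ 0 k ((1 : R) • Cochain.ofHom π) = 0
      rw [one_smul, δ_ofHom])

/-- A K-projective resolution `P → X`. Every complex of modules has one, and it is unique up to
homotopy equivalence. For such a `P`, the complex `Hom(P, Y)` is the right derived Hom complex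
`RHom(X, Y)`, and `P ⊗ Y` is the left derived tensor product of `X` and `Y`. -/
structure KProjRes (X : CochainComplex (ModuleCat.{u} R) ℤ) where
  /-- the resolving complex -/
  P : CochainComplex (ModuleCat.{u} R) ℤ
  /-- the augmentation -/
  π : P ⟶ X
  isKProjective : P.IsKProjective
  quasiIso : QuasiIso π

/-- The complex `RHom(X, Y)`, computed by a K-projective resolution of `X`. -/
abbrev RHom {X : CochainComplex (ModuleCat.{u} R) ℤ} (p : KProjRes X)
    (Y : CochainComplex (ModuleCat.{u} R) ℤ) : CochainComplex (ModuleCat.{u} R) ℤ :=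
  homComplex p.P Y

/-- The derived tensor product of `X` and `Y`, computed by a K-projective resolution of `X`. -/
abbrev LTensor {X : CochainComplex (ModuleCat.{u} R) ℤ} (p : KProjRes X)
    (Y : CochainComplex (ModuleCat.{u} R) ℤ) : CochainComplex (ModuleCat.{u} R) ℤ :=
  tensorObj p.P Y

/-- All but finitely many of the homology modules of `X` vanish. -/
def IsHomologicallyBounded (X : CochainComplex (ModuleCat.{u} R) ℤ) : Prop :=
  {i : ℤ | ¬ X.ExactAt i}.Finite

/-- `X` is homologically bounded and all its homology modules are finitely generated. -/
def IsHomologicallyFinite (X : CochainComplex (ModuleCat.{u} R) ℤ) : Prop :=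
  IsHomologicallyBounded X ∧ ∀ i : ℤ, Module.Finite R (X.homology i)

/-! A morphism of complexes is an isomorphism in the derived category if and only if it is a
quasi-isomorphism, and a complex is zero there if and only if it is acyclic. -/

/-- `A` is semidualizing: it is homologically finite, and the homothety morphism
`R → RHom(A, A)` is an isomorphism in the derived category. -/
def IsSemidualizing (A : CochainComplex (ModuleCat.{u} R) ℤ) : Prop :=
  IsHomologicallyFinite A ∧
    ∃ p : KProjRes A, QuasiIso (homothety p.π : ringComplex R ⟶ RHom p A)

/-- `N` is derived `A`-reflexive: `N` and `RHom(N, A)` are homologically finite, and the biduality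
morphism `N → RHom(RHom(N, A), A)` is an isomorphism in the derived category. This morphism is
represented by the composite `P → Hom(Hom(P, A), A) → Hom(Q, A)`, where `P → N` and
`Q → Hom(P, A)` are K-projective resolutions. -/
def IsDerivedReflexive (A N : CochainComplex (ModuleCat.{u} R) ℤ) : Prop :=
  IsHomologicallyFinite N ∧
    ∃ p : KProjRes N, IsHomologicallyFinite (RHom p A) ∧
      ∃ q : KProjRes (RHom p A),
        QuasiIso (biduality p.P A ≫ homComplexPrecomp q.π A : p.P ⟶ RHom q A)

/-- `N` is in the Bass class of `A`: `N` and `RHom(A, N)` are homologically bounded, and the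
evaluation morphism from the derived tensor product of `A` and `RHom(A, N)` to `N` is an
isomorphism in the derived category. -/
def InBassClass (A N : CochainComplex (ModuleCat.{u} R) ℤ) : Prop :=
  IsHomologicallyBounded N ∧
    ∃ p : KProjRes A, IsHomologicallyBounded (RHom p N) ∧
      QuasiIso (evaluation p.P N : LTensor p (RHom p N) ⟶ N)

/-- `N` is in the Auslander class of `A`: `N` and the derived tensor product of `A` and `N` are
homologically bounded, and the natural morphism from `N` to `RHom` from `A` to this tensor product
is an isomorphism in the derived category. -/
def InAuslanderClass (A N : CochainComplex (ModuleCat.{u} R) ℤ) : Prop :=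
  IsHomologicallyBounded N ∧
    ∃ p : KProjRes A, IsHomologicallyBounded (LTensor p N) ∧
      QuasiIso (coevaluation p.P N : N ⟶ RHom p (LTensor p N))

end DerivedMod

end

open DerivedMod

/-!
Derived functors are computed on K-projective resolutions throughout. For such a `P` the functor
`Hom(P, -)` preserves quasi-isomorphisms by definition, and `P ⊗ -` does so because
`Hom(P ⊗ W, J) = Hom(P, Hom(W, J))` is acyclic for `W` acyclic and `J` an injective module
(`acyclic_tensorObj`). Let `π : P ⟶ A` be a K-projective resolution, `E = Hom(P, A)`, and
`χ : R ⟶ E` the homothety, `r ↦ r • π`. If `χ` is a quasi-isomorphism, then `R` resolves `E`, and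
under the identifications `Hom(R, Y) = Y` and `P ⊗ R = P` the biduality, evaluation and coevaluation
morphisms turn into `π` or `χ`, which gives all implications from "`A` is semidualizing". The
Auslander class condition for `R` is the same statement as the one on `χ`.

The converses rest on two detection theorems over the local ring `R`, for complexes with bounded
and finitely generated cohomology.

* `acyclic_of_acyclic_homComplex`: if `RHom(C, Y)` is zero and `Y` is not, then `C` is zero. One
  replaces `Y` by an iterated cone of multiplications by generators of the maximal ideal; it stays
  nonzero by Nakayama's lemma, and its lowest cohomology module contains a copy of the residue field
  `k`, since it is killed by powers of these generators. The top cohomology of a nonzero `C` maps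
  onto `k`, and the resulting nonzero class in `RHom` is a contradiction.
* `acyclic_of_acyclic_tensorObj`: if the derived tensor product of `P` and `C` is zero and `P` is
  not, then `C` is zero, because the top cohomology modules of `P` and of `C` both map onto `k`, and
  so does their tensor product.

In all but one of the remaining converses, the triangle identities show that the functor `Hom(-, A)`
or `A ⊗ -` turns the morphism in question into a quasi-isomorphism, and the detection theorem is
applied to its mapping cone. If `A` is derived `A`-reflexive, this morphism is `χ`; if `RHom(A, A)`
is, it is the biduality morphism of `A`. For the Bass class it is again `χ`, and there one first
needs that `RHom(A, A)` has finitely generated cohomology (`finite_homology_homComplex`). The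
exception is the case that `RHom(A, A)` is semidualizing, where no detection theorem is needed: let
`Q` be a resolution of `E` and consider the maps `R ⟶ Hom(P, P) ⟶ Hom(Q, E) ⟶ E`, where `Hom(P, P)`
acts on `E` by precomposition and the last map evaluates at a cocycle lifting `π`. The composite of
the first two maps and that of the last two are quasi-isomorphisms, hence so is each of the three
maps.
-/

noncomputable section

namespace DerivedMod

open HomologicalComplex CochainComplex CochainComplex.HomComplex

variable {R : Type u} [CommRing R]

/-! ### Cocycles and cohomology classes -/

section Elementwise

variable {X Y Z : CochainComplex (ModuleCat.{u} R) ℤ}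

lemma d_d_apply (X : CochainComplex (ModuleCat.{u} R) ℤ) (i j k : ℤ) (x : X.X i) :
    (X.d j k).hom ((X.d i j).hom x) = 0 :=
  congrArg (fun f => f.hom x) (X.d_comp_d i j k)

lemma f_d_apply (f : X ⟶ Y) (i j : ℤ) (x : X.X i) :
    (f.f j).hom ((X.d i j).hom x) = (Y.d i j).hom ((f.f i).hom x) :=
  (congrArg (fun f => f.hom x) (f.comm i j)).symm

lemma exactAt_iff_exists {i j k : ℤ} (hij : i + 1 = j) (hjk : j + 1 = k) :
    X.ExactAt j ↔ ∀ x : X.X j, (X.d j k).hom x = 0 → ∃ w : X.X i, (X.d i j).hom w = x := by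
  rw [X.exactAt_iff' i j k (by simp; lia) (by simp; lia)]
  exact ShortComplex.moduleCat_exact_iff _

/-- A cocycle, viewed as an element of the abstract object of cycles. -/
def toCyclesMap (X : CochainComplex (ModuleCat.{u} R) ℤ) (j : ℤ) :
    LinearMap.ker (X.d j (j + 1)).hom →ₗ[R] X.cycles j :=
  (X.liftCycles (ModuleCat.ofHom (LinearMap.ker (X.d j (j + 1)).hom).subtype) (j + 1) (by simp)
    (ModuleCat.hom_ext (LinearMap.ext fun x => x.2))).hom

lemma iCycles_toCyclesMap (j : ℤ) (z : LinearMap.ker (X.d j (j + 1)).hom) :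
    (X.iCycles j).hom (toCyclesMap X j z) = z :=
  congrArg (fun f => f.hom z) (X.liftCycles_i (ModuleCat.ofHom (LinearMap.ker
    (X.d j (j + 1)).hom).subtype) (j + 1) (by simp)
      (ModuleCat.hom_ext (LinearMap.ext fun x => x.2)))

lemma iCycles_injective (X : CochainComplex (ModuleCat.{u} R) ℤ) (j : ℤ) :
    Function.Injective (X.iCycles j).hom :=
  (ModuleCat.mono_iff_injective (X.iCycles j)).1 inferInstance

/-- The map sending a cocycle to its cohomology class. -/
def toHomology (X : CochainComplex (ModuleCat.{u} R) ℤ) (j : ℤ) :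
    LinearMap.ker (X.d j (j + 1)).hom →ₗ[R] X.homology j :=
  (X.homologyπ j).hom ∘ₗ toCyclesMap X j

lemma toHomology_surjective (X : CochainComplex (ModuleCat.{u} R) ℤ) (j : ℤ) :
    Function.Surjective (toHomology X j) := by
  intro h
  obtain ⟨c, rfl⟩ := (ModuleCat.epi_iff_surjective (X.homologyπ j)).1 inferInstance h
  have hc : (X.d j (j + 1)).hom ((X.iCycles j).hom c) = 0 :=
    congrArg (fun f => f.hom c) (X.iCycles_d j (j + 1))
  exact ⟨⟨(X.iCycles j).hom c, hc⟩, congrArg (X.homologyπ j).hom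
    (iCycles_injective X j (iCycles_toCyclesMap _ _))⟩

lemma toHomology_eq_zero_iff {i j : ℤ} (hij : i + 1 = j)
    (z : LinearMap.ker (X.d j (j + 1)).hom) :
    toHomology X j z = 0 ↔ ∃ w : X.X i, (X.d i j).hom w = z := by
  have hex : (ShortComplex.mk (X.toCycles i j) (X.homologyπ j) (by simp)).Exact :=
    ShortComplex.exact_of_g_is_cokernel _ (X.homologyIsCokernel i j (by simp; lia))
  have hi (w : X.X i) : (X.iCycles j).hom ((X.toCycles i j).hom w) = (X.d i j).hom w :=
    congrArg (fun f => f.hom w) (X.toCycles_i i j)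
  constructor
  · intro h
    obtain ⟨w, hw⟩ := (ShortComplex.moduleCat_exact_iff _).1 hex _ h
    exact ⟨w, (hi w).symm.trans ((congrArg (X.iCycles j).hom hw).trans (iCycles_toCyclesMap j z))⟩
  · rintro ⟨w, hw⟩
    have h1 : (X.toCycles i j).hom w = toCyclesMap X j z :=
      iCycles_injective X j ((hi w).trans (hw.trans (iCycles_toCyclesMap j z).symm))
    refine (congrArg (X.homologyπ j).hom h1.symm).trans ?_
    exact congrArg (fun f => f.hom w) (X.toCycles_comp_homologyπ i j)

lemma toHomology_map (f : X ⟶ Y) (j : ℤ) (x : X.X j) (hx : (X.d j (j + 1)).hom x = 0)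
    (h : (Y.d j (j + 1)).hom ((f.f j).hom x) = 0) :
    (homologyMap f j).hom (toHomology X j ⟨x, hx⟩) = toHomology Y j ⟨(f.f j).hom x, h⟩ := by
  have h1 := congrArg (fun f => f.hom (toCyclesMap X j ⟨x, hx⟩)) (homologyπ_naturality f j)
  refine h1.trans (congrArg (Y.homologyπ j).hom (iCycles_injective Y j ?_))
  refine Eq.trans ?_ (iCycles_toCyclesMap j _).symm
  refine (congrArg (fun f => f.hom (toCyclesMap X j ⟨x, hx⟩)) (cyclesMap_i f j)).trans ?_
  exact congrArg (f.f j).hom (iCycles_toCyclesMap j ⟨x, hx⟩)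

/-- A chain map is a quasi-isomorphism when it is injective and surjective on classes of
cocycles. -/
lemma quasiIso_iff_exists (f : X ⟶ Y) :
    QuasiIso f ↔
      (∀ i j : ℤ, i + 1 = j → ∀ x : X.X j, (X.d j (j + 1)).hom x = 0 →
        (∃ v : Y.X i, (Y.d i j).hom v = (f.f j).hom x) → ∃ w : X.X i, (X.d i j).hom w = x) ∧
      (∀ i j : ℤ, i + 1 = j → ∀ y : Y.X j, (Y.d j (j + 1)).hom y = 0 →
        ∃ x : X.X j, (X.d j (j + 1)).hom x = 0 ∧
          ∃ v : Y.X i, y = (f.f j).hom x + (Y.d i j).hom v) := by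
  have hz {j : ℤ} {x : X.X j} (hx : (X.d j (j + 1)).hom x = 0) :
      (Y.d j (j + 1)).hom ((f.f j).hom x) = 0 := by rw [← f_d_apply, hx, map_zero]
  have hinj (i j : ℤ) (hij : i + 1 = j) : Function.Injective (homologyMap f j).hom ↔
      ∀ x : X.X j, (X.d j (j + 1)).hom x = 0 →
        (∃ v : Y.X i, (Y.d i j).hom v = (f.f j).hom x) → ∃ w : X.X i, (X.d i j).hom w = x := by
    rw [injective_iff_map_eq_zero]
    constructor
    · intro h x hx hv
      have := h (toHomology X j ⟨x, hx⟩)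
      rw [toHomology_map _ _ _ hx (hz hx), toHomology_eq_zero_iff hij,
        toHomology_eq_zero_iff hij] at this
      exact this hv
    · intro h a
      obtain ⟨⟨x, hx⟩, rfl⟩ := toHomology_surjective X j a
      rw [toHomology_map _ _ _ hx (hz hx), toHomology_eq_zero_iff hij, toHomology_eq_zero_iff hij]
      exact h x hx
  have hsurj (i j : ℤ) (hij : i + 1 = j) : Function.Surjective (homologyMap f j).hom ↔
      ∀ y : Y.X j, (Y.d j (j + 1)).hom y = 0 →
        ∃ x : X.X j, (X.d j (j + 1)).hom x = 0 ∧
          ∃ v : Y.X i, y = (f.f j).hom x + (Y.d i j).hom v := by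
    have key (x : X.X j) (hx : (X.d j (j + 1)).hom x = 0) (y : Y.X j)
        (hy : (Y.d j (j + 1)).hom y = 0) :
        (homologyMap f j).hom (toHomology X j ⟨x, hx⟩) = toHomology Y j ⟨y, hy⟩ ↔
        ∃ v : Y.X i, y = (f.f j).hom x + (Y.d i j).hom v := by
      rw [toHomology_map _ _ _ hx (hz hx), eq_comm, ← sub_eq_zero, ← map_sub,
        toHomology_eq_zero_iff hij]
      refine exists_congr fun v => ?_
      change _ = y - (f.f j).hom x ↔ _
      rw [eq_sub_iff_add_eq', eq_comm]
    constructor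
    · intro h y hy
      obtain ⟨a, ha⟩ := h (toHomology Y j ⟨y, hy⟩)
      obtain ⟨⟨x, hx⟩, rfl⟩ := toHomology_surjective X j a
      exact ⟨x, hx, (key x hx y hy).1 ha⟩
    · intro h b
      obtain ⟨⟨y, hy⟩, rfl⟩ := toHomology_surjective Y j b
      obtain ⟨x, hx, hv⟩ := h y hy
      exact ⟨_, (key x hx y hy).2 hv⟩
  rw [quasiIso_iff]
  have hiso (j : ℤ) : QuasiIsoAt f j ↔ Function.Injective (homologyMap f j).hom ∧
      Function.Surjective (homologyMap f j).hom := by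
    rw [quasiIsoAt_iff_isIso_homologyMap, ConcreteCategory.isIso_iff_bijective]
    rfl
  simp only [hiso]
  constructor
  · intro h
    refine ⟨fun i j hij => (hinj i j hij).1 (h j).1, fun i j hij => (hsurj i j hij).1 (h j).2⟩
  · intro h j
    exact ⟨(hinj (j - 1) j (by lia)).2 (h.1 _ _ (by lia)),
      (hsurj (j - 1) j (by lia)).2 (h.2 _ _ (by lia))⟩

/-- The map out of cohomology induced by a map on cocycles that vanishes on coboundaries. -/
lemma exists_homology_desc {i j : ℤ} (hij : i + 1 = j) {N : Type*} [AddCommGroup N] [Module R N]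
    (g : LinearMap.ker (X.d j (j + 1)).hom →ₗ[R] N)
    (hg : ∀ z, (∃ w, (X.d i j).hom w = z.1) → g z = 0) :
    ∃ g' : X.homology j →ₗ[R] N, ∀ z, g' (toHomology X j z) = g z := by
  let e := (toHomology X j).quotKerEquivOfSurjective (toHomology_surjective X j)
  have hle : LinearMap.ker (toHomology X j) ≤ LinearMap.ker g :=
    fun z hz => hg z ((toHomology_eq_zero_iff hij z).1 hz)
  refine ⟨Submodule.liftQ _ g hle ∘ₗ e.symm.toLinearMap, fun z => ?_⟩
  have : e.symm (toHomology X j z) = Submodule.Quotient.mk z := by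
    rw [LinearEquiv.symm_apply_eq]; rfl
  exact (congrArg (Submodule.liftQ _ g hle) this).trans (Submodule.liftQ_apply _ _ _)

/-- Finite generation of the middle cohomology in an exact sequence given on the level of
cocycles. -/
lemma finite_homology_of_exact [IsNoetherianRing R] {a a' b b' : ℤ} (ha : a' + 1 = a)
    (hb : b' + 1 = b) (f : X.X a →ₗ[R] Y.X b) {N : Type*} [AddCommGroup N] [Module R N]
    [Module.Finite R N] (g : LinearMap.ker (Y.d b (b + 1)).hom →ₗ[R] N)
    (hf : ∀ x, (X.d a (a + 1)).hom x = 0 → (Y.d b (b + 1)).hom (f x) = 0)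
    (hf' : ∀ x, ∃ w, (Y.d b' b).hom w = f ((X.d a' a).hom x))
    (hg : ∀ y, (∃ w, (Y.d b' b).hom w = y.1) → g y = 0)
    (hex : ∀ y, g y = 0 → ∃ x, (X.d a (a + 1)).hom x = 0 ∧ ∃ w, y.1 = f x + (Y.d b' b).hom w)
    [Module.Finite R (X.homology a)] : Module.Finite R (Y.homology b) := by
  obtain ⟨g', hg'⟩ := exists_homology_desc hb g hg
  let f₀ : LinearMap.ker (X.d a (a + 1)).hom →ₗ[R] LinearMap.ker (Y.d b (b + 1)).hom :=
    f.restrict fun x hx => hf x hx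
  obtain ⟨f', hf''⟩ := exists_homology_desc ha (toHomology Y b ∘ₗ f₀) (by
    rintro z ⟨w, hw⟩
    refine (toHomology_eq_zero_iff hb _).2 ?_
    obtain ⟨w', hw'⟩ := hf' w
    exact ⟨w', hw'.trans (congrArg f hw)⟩)
  have hle : LinearMap.ker g' ≤ LinearMap.range f' := by
    intro h hh
    obtain ⟨y, rfl⟩ := toHomology_surjective Y b h
    obtain ⟨x, hx, w, hw⟩ := hex y ((hg' y).symm.trans hh)
    refine ⟨toHomology X a ⟨x, hx⟩, ?_⟩
    rw [hf'', eq_comm, ← sub_eq_zero, LinearMap.comp_apply, ← map_sub, toHomology_eq_zero_iff hb]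
    exact ⟨w, (sub_eq_of_eq_add' hw).symm⟩
  have : IsNoetherian R (LinearMap.range f') := isNoetherian_of_isNoetherianRing_of_finite _ _
  have : IsNoetherian R (LinearMap.ker g') := isNoetherian_of_le hle
  have : IsNoetherian R N := isNoetherian_of_isNoetherianRing_of_finite _ _
  have : IsNoetherian R (Y.homology b) :=
    isNoetherian_of_range_eq_ker (LinearMap.ker g').subtype g' (by simp)
  infer_instance

end Elementwise

/-! ### Hom complexes -/

section HomLemmas

variable {X Y Z P : CochainComplex (ModuleCat.{u} R) ℤ}

lemma evalAt_add {n : ℤ} (f g : Cochain X Y n) (p q : ℤ) (h : p + n = q) (x : X.X p) :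
    evalAt (f + g) p q h x = evalAt f p q h x + evalAt g p q h x := rfl

lemma evalAt_map_add {n : ℤ} (f : Cochain X Y n) (p q : ℤ) (h : p + n = q) (x y : X.X p) :
    evalAt f p q h (x + y) = evalAt f p q h x + evalAt f p q h y := map_add _ _ _

lemma evalAt_map_smul {n : ℤ} (f : Cochain X Y n) (p q : ℤ) (h : p + n = q) (r : R) (x : X.X p) :
    evalAt f p q h (r • x) = r • evalAt f p q h x := map_smul _ _ _

lemma evalAt_map_zero {n : ℤ} (f : Cochain X Y n) (p q : ℤ) (h : p + n = q) :
    evalAt f p q h 0 = 0 := map_zero _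

lemma evalAt_map_units_smul {n : ℤ} (f : Cochain X Y n) (p q : ℤ) (h : p + n = q) (e : ℤˣ)
    (x : X.X p) : evalAt f p q h (e • x) = e • evalAt f p q h x := by
  unfold evalAt
  rw [Units.smul_def, map_zsmul, ← Units.smul_def]

lemma evalAt_ofHom (f : X ⟶ Y) (p : ℤ) (h : p + 0 = p) (x : X.X p) :
    evalAt (Cochain.ofHom f) p p h x = (f.f p).hom x := by
  unfold evalAt
  rw [Cochain.ofHom_v]

lemma evalAt_comp {n m k : ℤ} (f : Cochain X Y n) (g : Cochain Y Z m) (h : n + m = k) (p q r : ℤ)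
    (hpq : p + n = q) (hqr : q + m = r) (x : X.X p) :
    evalAt (f.comp g h) p r (by lia) x = evalAt g q r hqr (evalAt f p q hpq x) := by
  unfold evalAt
  rw [Cochain.comp_v _ _ h p q r hpq hqr]
  rfl

lemma homComplex_exactAt_iff {i j k : ℤ} (hij : i + 1 = j) (hjk : j + 1 = k) :
    (homComplex X Y).ExactAt j ↔
      ∀ z : Cochain X Y j, δ j k z = 0 → ∃ w : Cochain X Y i, δ i j w = z :=
  exactAt_iff_exists (X := homComplex X Y) hij hjk

/-- Covariant functoriality of the Hom complex. -/
def homComplexPostcomp (P : CochainComplex (ModuleCat.{u} R) ℤ) (f : X ⟶ Y) :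
    homComplex P X ⟶ homComplex P Y where
  f n := ModuleCat.ofHom
    { toFun := fun (z : Cochain P X n) => z.comp (Cochain.ofHom f) (add_zero n)
      map_add' := fun _ _ => Cochain.add_comp _ _ _ _
      map_smul' := fun _ _ => Cochain.smul_comp _ _ _ _ }
  comm' _ j _ := ModuleCat.hom_ext (LinearMap.ext fun z => δ_comp_ofHom z f j)

/-- The Hom complex from a K-projective complex to an acyclic one is acyclic in all degrees, not
only in degree zero, which is the definition of K-projectivity. -/
lemma acyclic_homComplex [P.IsKProjective] (hY : Y.Acyclic) : (homComplex P Y).Acyclic := by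
  intro n
  rw [homComplex_exactAt_iff (i := n - 1) (by lia) rfl]
  intro z hz
  have h0 : (CohomologyClass.toHom (CohomologyClass.mk (Cocycle.mk z (n + 1) rfl hz))) = 0 := by
    rw [CohomologyClass.toHom_mk]
    apply IsKProjective.leftOrthogonal P
    refine (HomotopyCategory.subcategoryAcyclic _).prop_of_iso
      (((HomotopyCategory.quotient _ (.up ℤ)).commShiftIso n).symm.app Y) ?_
    refine (HomotopyCategory.subcategoryAcyclic _).le_shift n _ ?_
    rwa [HomotopyCategory.quotient_obj_mem_subcategoryAcyclic_iff_acyclic]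
  rw [CohomologyClass.toHom_mk_eq_zero_iff, mem_coboundaries_iff _ (n - 1) (by lia)] at h0
  exact h0

end HomLemmas

/-! ### Mapping cones -/

section Cone

variable {F G X Y P : CochainComplex (ModuleCat.{u} R) ℤ} (f : F ⟶ G)

/-- The first component of an element of a mapping cone. -/
def coneFst (n m : ℤ) (h : n + 1 = m) : (mappingCone f).X n →ₗ[R] F.X m :=
  ((mappingCone.fst f).1.v n m h).hom

/-- The second component of an element of a mapping cone. -/
def coneSnd (n : ℤ) : (mappingCone f).X n →ₗ[R] G.X n :=
  ((mappingCone.snd f).v n n (add_zero n)).hom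

/-- The element of a mapping cone with given components. -/
def coneMk {n m : ℤ} (h : n + 1 = m) (u : F.X m) (v : G.X n) : (mappingCone f).X n :=
  ((mappingCone.inl f).v m n (by lia)).hom u + ((mappingCone.inr f).f n).hom v

variable {f}

lemma coneFst_mk {n m : ℤ} (h : n + 1 = m) (u : F.X m) (v : G.X n) :
    coneFst f n m h (coneMk f h u v) = u := by
  have h1 := congrArg (fun g => g.hom u) (mappingCone.inl_v_fst_v f m n h)
  have h2 := congrArg (fun g => g.hom v) (mappingCone.inr_f_fst_v f n m h)
  exact (map_add _ _ _).trans ((congrArg₂ (· + ·) h1 h2).trans (add_zero u))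

lemma coneSnd_mk {n m : ℤ} (h : n + 1 = m) (u : F.X m) (v : G.X n) :
    coneSnd f n (coneMk f h u v) = v := by
  have h1 := congrArg (fun g => g.hom u) (mappingCone.inl_v_snd_v f m n (by lia))
  have h2 := congrArg (fun g => g.hom v) (mappingCone.inr_f_snd_v f n)
  exact (map_add _ _ _).trans ((congrArg₂ (· + ·) h1 h2).trans (zero_add v))

lemma cone_ext {n m : ℤ} (h : n + 1 = m) {x y : (mappingCone f).X n}
    (h1 : coneFst f n m h x = coneFst f n m h y) (h2 : coneSnd f n x = coneSnd f n y) : x = y := by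
  have key (x : (mappingCone f).X n) : coneMk f h (coneFst f n m h x) (coneSnd f n x) = x :=
    congrArg (fun g => g.hom x) (mappingCone.id_X f n m h)
  rw [← key x, ← key y, h1, h2]

lemma coneFst_d {i j k : ℤ} (hij : i + 1 = j) (hjk : j + 1 = k) (x : (mappingCone f).X i) :
    coneFst f j k hjk (((mappingCone f).d i j).hom x) = - (F.d j k).hom (coneFst f i j hij x) :=
  congrArg (fun g => g.hom x) (mappingCone.d_fst_v f i j k hij hjk)

lemma coneSnd_d {i j : ℤ} (hij : i + 1 = j) (x : (mappingCone f).X i) :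
    coneSnd f j (((mappingCone f).d i j).hom x) =
      (f.f j).hom (coneFst f i j hij x) + (G.d i j).hom (coneSnd f i x) :=
  congrArg (fun g => g.hom x) (mappingCone.d_snd_v f i j hij)

lemma cone_d_eq_zero_iff {i j k : ℤ} (hij : i + 1 = j) (hjk : j + 1 = k)
    (x : (mappingCone f).X i) : ((mappingCone f).d i j).hom x = 0 ↔
      (F.d j k).hom (coneFst f i j hij x) = 0 ∧
      (f.f j).hom (coneFst f i j hij x) + (G.d i j).hom (coneSnd f i x) = 0 := by
  constructor
  · intro h
    rw [← coneSnd_d hij, h, map_zero, ← neg_eq_zero, ← coneFst_d hij hjk, h, map_zero]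
    exact ⟨rfl, rfl⟩
  · rintro ⟨h1, h2⟩
    refine cone_ext hjk ?_ ?_
    · rw [coneFst_d hij, h1, map_zero, neg_zero]
    · rw [coneSnd_d hij, h2, map_zero]

lemma d_coneMk {i j k : ℤ} (hij : i + 1 = j) (hjk : j + 1 = k) (u : F.X j) (v : G.X i) :
    ((mappingCone f).d i j).hom (coneMk f hij u v) =
      coneMk f hjk (-(F.d j k).hom u) ((f.f j).hom u + (G.d i j).hom v) := by
  refine cone_ext hjk ?_ ?_
  · rw [coneFst_d hij, coneFst_mk, coneFst_mk]
  · rw [coneSnd_d hij, coneSnd_mk, coneSnd_mk, coneFst_mk]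

lemma quasiIso_iff_acyclic_mappingCone : QuasiIso f ↔ (mappingCone f).Acyclic := by
  rw [quasiIso_iff_exists]
  constructor
  · rintro ⟨hinj, hsurj⟩ n
    rw [exactAt_iff_exists (i := n - 1) (by lia) rfl]
    intro x hx
    obtain ⟨h1, h2⟩ := (cone_d_eq_zero_iff rfl rfl x).1 hx
    obtain ⟨w, hw⟩ := hinj n (n + 1) rfl _ h1
      ⟨-coneSnd f n x, by rw [map_neg]; exact neg_eq_of_add_eq_zero_left h2⟩
    obtain ⟨u, hu, v, hv⟩ := hsurj (n - 1) n (by lia) (coneSnd f n x + (f.f n).hom w) (by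
      rw [map_add, ← f_d_apply, hw]
      exact (add_comm _ _).trans h2)
    refine ⟨coneMk f (by lia) (u - w) v, ?_⟩
    rw [d_coneMk _ rfl]
    refine cone_ext rfl ?_ ?_
    · rw [coneFst_mk, map_sub, hu, hw, zero_sub, neg_neg]
    · rw [coneSnd_mk, map_sub, sub_add_eq_add_sub, ← hv, add_sub_cancel_right]
  · intro h
    constructor
    · rintro i j rfl x hx ⟨v, hv⟩
      obtain ⟨w, hw⟩ := (exactAt_iff_exists (i := i - 1) (by lia) rfl).1 (h i)
        (coneMk f rfl x (-v)) (by
          rw [cone_d_eq_zero_iff rfl rfl, coneFst_mk, coneSnd_mk, map_neg, hv, add_neg_cancel]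
          exact ⟨hx, rfl⟩)
      refine ⟨-coneFst f (i - 1) i (by lia) w, ?_⟩
      rw [map_neg, ← coneFst_d _ rfl, hw, coneFst_mk]
    · rintro i j rfl y hy
      obtain ⟨w, hw⟩ := (exactAt_iff_exists (i := i) rfl rfl).1 (h (i + 1))
        (coneMk f rfl 0 y) (by
          rw [cone_d_eq_zero_iff rfl rfl, coneFst_mk, coneSnd_mk, hy, map_zero, map_zero, add_zero]
          exact ⟨rfl, rfl⟩)
      refine ⟨coneFst f i (i + 1) rfl w, ?_, coneSnd f i w, ?_⟩
      · rw [← neg_eq_zero, ← coneFst_d _ rfl, hw, coneFst_mk]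
      · rw [← coneSnd_d, hw, coneSnd_mk]

/-- Maps out of a K-projective complex do not see the difference between quasi-isomorphic
complexes. -/
lemma quasiIso_homComplexPostcomp [P.IsKProjective] (hf : QuasiIso f) :
    QuasiIso (homComplexPostcomp P f) := by
  have hac := acyclic_homComplex (P := P) (quasiIso_iff_acyclic_mappingCone.1 hf)
  rw [quasiIso_iff_exists]
  constructor
  · rintro i n rfl (z : Cochain P F (i + 1)) (hz : δ _ _ z = 0) ⟨(v : Cochain P G i),
      (hv : δ i (i + 1) v = z.comp (Cochain.ofHom f) (add_zero _))⟩
    obtain ⟨w, hw⟩ := (homComplex_exactAt_iff (i := i - 1) (by lia) rfl).1 (hac i)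
      (mappingCone.liftCochain f (-z) v rfl) (by
        rw [mappingCone.δ_liftCochain _ _ _ _ _ rfl, δ_neg, hz, hv]
        simp)
    refine ⟨w.comp (mappingCone.fst f).1 (by lia), ?_⟩
    change δ i (i + 1) _ = z
    rw [δ_comp w (mappingCone.fst f).1 _ i 2 (i + 1) rfl (by lia) rfl, hw]
    simp
  · rintro i n rfl (y : Cochain P G (i + 1)) (hy : δ _ _ y = 0)
    obtain ⟨w, hw⟩ := (homComplex_exactAt_iff (i := i) rfl rfl).1 (hac (i + 1))
      (y.comp (Cochain.ofHom (mappingCone.inr f)) (add_zero _)) (by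
        rw [δ_comp_ofHom, hy, Cochain.zero_comp])
    refine ⟨w.comp (mappingCone.fst f).1 rfl, ?_, w.comp (mappingCone.snd f) (add_zero _), ?_⟩
    · change δ (i + 1) _ _ = 0
      rw [δ_comp w (mappingCone.fst f).1 _ (i + 1) 2 (i + 1 + 1) rfl rfl rfl, hw]
      simp
    · change y = (w.comp (mappingCone.fst f).1 rfl).comp (Cochain.ofHom f) (add_zero _) +
        δ i (i + 1) (w.comp (mappingCone.snd f) (add_zero _))
      rw [δ_comp_zero_cochain _ _ _ rfl, hw]
      simp

/-- Maps from a K-projective complex lift along quasi-isomorphisms, up to homotopy. -/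
lemma exists_homotopy_lift [P.IsKProjective] (hf : QuasiIso f) (g : P ⟶ G) :
    ∃ g' : P ⟶ F, Nonempty (Homotopy (g' ≫ f) g) := by
  obtain ⟨(z : Cochain P F 0), hz, (v : Cochain P G (-1)),
      (hv : Cochain.ofHom g = z.comp (Cochain.ofHom f) _ + δ (-1) 0 v)⟩ :=
    ((quasiIso_iff_exists _).1 (quasiIso_homComplexPostcomp (P := P) hf)).2 (-1) 0 rfl
    (Cochain.ofHom g) (δ_ofHom g)
  refine ⟨Cocycle.homOf (Cocycle.mk z 1 rfl hz), ⟨Homotopy.symm ?_⟩⟩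
  refine (Cochain.equivHomotopy _ _).symm ⟨v, ?_⟩
  rw [hv, Cochain.ofHom_comp, Cocycle.cochain_ofHom_homOf_eq_coe, add_comm]
  rfl

lemma quasiIso_of_homotopy {g g' : F ⟶ G} (h : Homotopy g g') (hg : QuasiIso g) : QuasiIso g' := by
  rw [quasiIso_iff] at hg ⊢
  intro i
  rw [quasiIsoAt_iff_isIso_homologyMap, ← h.homologyMap_eq i, ← quasiIsoAt_iff_isIso_homologyMap]
  exact hg i

/-- If precomposition with `f : F ⟶ G` induces a quasi-isomorphism of Hom complexes into `Y`, then
the Hom complex from the cone of `f` to `Y` is acyclic. -/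
lemma acyclic_homComplex_mappingCone (h : QuasiIso (homComplexPrecomp f Y)) :
    (homComplex (mappingCone f) Y).Acyclic := by
  rw [quasiIso_iff_exists] at h
  intro n
  rw [homComplex_exactAt_iff (i := n - 1) (by lia) rfl]
  intro z hz
  obtain ⟨m, rfl⟩ : ∃ m, n = m + 1 + 1 := ⟨n - 2, by lia⟩
  have hm : m + 1 + 1 - 1 = m + 1 := by lia
  rw [hm]
  obtain ⟨(b : Cochain G Y (m + 1)), hb⟩ := h.1 (m + 1) (m + 1 + 1) rfl
    ((Cochain.ofHom (mappingCone.inr f)).comp z (zero_add _))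
    (by
      change δ _ _ _ = 0
      rw [δ_ofHom_comp, hz, Cochain.comp_zero])
    ⟨(m + 1 + 1).negOnePow • (mappingCone.inl f).comp z (show _ = m + 1 by lia), by
      change δ (m + 1) (m + 1 + 1) (_ • _) = (Cochain.ofHom f).comp
        ((Cochain.ofHom (mappingCone.inr f)).comp z (zero_add _)) (zero_add _)
      rw [δ_units_smul, δ_comp _ z _ 0 _ _ rfl rfl rfl, hz, mappingCone.δ_inl, Cochain.comp_zero,
        zero_add, smul_smul, ← Int.negOnePow_add, Int.negOnePow_even _ (by simp), one_smul,
        Cochain.ofHom_comp, Cochain.comp_assoc_of_first_is_zero_cochain]⟩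
  replace hb : δ (m + 1) (m + 1 + 1) b =
    (Cochain.ofHom (mappingCone.inr f)).comp z (zero_add _) := hb
  obtain ⟨(g : Cochain G Y (m + 1)), (hg : δ _ _ g = 0), (v : Cochain F Y m), hv⟩ :=
    h.2 m (m + 1) rfl
    ((mappingCone.inl f).comp z (show _ = m + 1 by lia) -
      (m + 1 + 1).negOnePow • (Cochain.ofHom f).comp b (zero_add _)) (by
      change δ (m + 1) (m + 1 + 1) (_ - _) = 0
      rw [δ_sub, δ_units_smul, δ_comp _ z _ 0 _ _ rfl rfl rfl, hz, mappingCone.δ_inl,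
        Cochain.comp_zero, zero_add, δ_ofHom_comp, hb, Cochain.ofHom_comp,
        Cochain.comp_assoc_of_first_is_zero_cochain, sub_self])
  replace hv : (mappingCone.inl f).comp z (show _ = m + 1 by lia) -
      (m + 1 + 1).negOnePow • (Cochain.ofHom f).comp b (zero_add _) =
      (Cochain.ofHom f).comp g (zero_add _) + δ m (m + 1) v := hv
  refine ⟨mappingCone.descCochain f v (b + (m + 1 + 1).negOnePow • g) rfl, ?_⟩
  rw [mappingCone.δ_descCochain _ _ _ _ _ rfl, mappingCone.ext_cochain_from_iff f (m + 1) _ rfl]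
  constructor
  · rw [sub_eq_iff_eq_add] at hv
    simp only [hv, Cochain.comp_add, Cochain.comp_units_smul, mappingCone.inl_fst_assoc,
      mappingCone.inl_snd_assoc, smul_add, smul_smul, Int.units_mul_self, one_smul, add_zero]
    abel
  · simp [hb, hg]

lemma isKProjective_mappingCone (hF : F.IsKProjective) (hG : G.IsKProjective) :
    (mappingCone f).IsKProjective where
  nonempty_homotopy_zero {L} g hL := by
    have hq : QuasiIso (homComplexPrecomp f L) := by
      rw [quasiIso_iff]
      intro i
      exact (quasiIsoAt_iff_exactAt _ _ (acyclic_homComplex hL i)).2 (acyclic_homComplex hL i)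
    obtain ⟨w, hw⟩ := (homComplex_exactAt_iff (i := -1) (j := 0) (k := 1) (by lia) (by lia)).1
      (acyclic_homComplex_mappingCone hq 0) (Cochain.ofHom g) (δ_ofHom g)
    exact ⟨(Cochain.equivHomotopy _ _).symm ⟨w, by simp [hw]⟩⟩

end Cone

/-! ### Tensor products of complexes -/

section Tensor

variable {X Y Z P : CochainComplex (ModuleCat.{u} R) ℤ}

/-- The linear map out of a term of a tensor product of complexes given by a family of bilinear
maps. -/
def tensorDesc {n : ℤ} {M : Type u} [AddCommGroup M] [Module R M]
    (φ : ∀ p q : ℤ, p + q = n → X.X p →ₗ[R] Y.X q →ₗ[R] M) : (tensorObj X Y).X n →ₗ[R] M :=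
  (mapBifunctorDesc (K₁ := X) (K₂ := Y) (c := ComplexShape.up ℤ)
    (F := MonoidalCategory.curriedTensor _) (A := ModuleCat.of R M)
    fun p q h => ModuleCat.ofHom (TensorProduct.lift (φ p q h))).hom

lemma tensorDesc_tmul {n : ℤ} {M : Type u} [AddCommGroup M] [Module R M]
    (φ : ∀ p q : ℤ, p + q = n → X.X p →ₗ[R] Y.X q →ₗ[R] M) {p q : ℤ} (h : p + q = n) (x : X.X p)
    (y : Y.X q) : tensorDesc φ (tmul h x y) = φ p q h x y :=
  (congrArg (fun g => g.hom (TensorProduct.tmul R x y))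
    (ι_mapBifunctorDesc (K₁ := X) (K₂ := Y) (c := ComplexShape.up ℤ)
      (F := MonoidalCategory.curriedTensor _) (A := ModuleCat.of R M)
      (fun p q h => ModuleCat.ofHom (TensorProduct.lift (φ p q h))) p q h)).trans
    (TensorProduct.lift.tmul x y)

lemma tensor_linearMap_ext {n : ℤ} {M : Type u} [AddCommGroup M] [Module R M]
    {f g : (tensorObj X Y).X n →ₗ[R] M}
    (h : ∀ (p q : ℤ) (hpq : p + q = n) (x : X.X p) (y : Y.X q),
      f (tmul hpq x y) = g (tmul hpq x y)) : f = g := by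
  have : ModuleCat.ofHom f = ModuleCat.ofHom g :=
    mapBifunctor.hom_ext fun p q hpq => ModuleCat.hom_ext <| TensorProduct.ext' fun x y =>
      h p q hpq x y
  exact congrArg ModuleCat.Hom.hom this

lemma tensor_cochain_ext {n : ℤ} {f g : Cochain (tensorObj X Y) Z n}
    (h : ∀ (p q i j : ℤ) (hi : p + q = i) (hj : i + n = j) (x : X.X p) (y : Y.X q),
      evalAt f i j hj (tmul hi x y) = evalAt g i j hj (tmul hi x y)) : f = g :=
  Cochain.ext _ _ fun i j hj => ModuleCat.hom_ext <|
    tensor_linearMap_ext fun p q hi x y => h p q i j hi hj x y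

/-- The bilinear map `(x, y) ↦ x ⊗ y`. -/
def tmulBilin (X Y : CochainComplex (ModuleCat.{u} R) ℤ) {p q n : ℤ} (h : p + q = n) :
    X.X p →ₗ[R] Y.X q →ₗ[R] (tensorObj X Y).X n :=
  LinearMap.mk₂ R (fun x y => (tmul h x y : (tensorObj X Y).X n)) (add_tmul h)
    (fun r x y => smul_tmul h r x y) (tmul_add h) (fun r x y => tmul_smul h r x y)

lemma tmulBilin_apply {p q n : ℤ} (h : p + q = n) (x : X.X p) (y : Y.X q) :
    tmulBilin X Y h x y = tmul h x y := rfl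

lemma tmul_units_smul {p q n : ℤ} (h : p + q = n) (e : ℤˣ) (x : X.X p) (y : Y.X q) :
    (tmul h x (e • y) : (tensorObj X Y).X n) = e • tmul h x y := by
  rw [← tmulBilin_apply, ← tmulBilin_apply, Units.smul_def, map_zsmul, ← Units.smul_def]

lemma tmul_zero {p q n : ℤ} (h : p + q = n) (x : X.X p) :
    (tmul h x 0 : (tensorObj X Y).X n) = 0 := by
  have := tmul_smul (Y := Y) h 0 x 0
  rwa [zero_smul, zero_smul] at this

lemma zero_tmul {p q n : ℤ} (h : p + q = n) (y : Y.X q) :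
    (tmul h (0 : X.X p) y : (tensorObj X Y).X n) = 0 := by
  have := smul_tmul (X := X) h 0 0 y
  rwa [zero_smul, zero_smul] at this

/-- The components of the cochain `1 ⊗ g`. -/
def tensorCochainAux (P : CochainComplex (ModuleCat.{u} R) ℤ) {n i j : ℤ} (hij : i + n = j)
    (g : Cochain X Y n) (p q : ℤ) (h : p + q = i) :
    P.X p →ₗ[R] X.X q →ₗ[R] (tensorObj P Y).X j :=
  (n * p).negOnePow •
    (tmulBilin P Y (show p + (q + n) = j by lia)).compl₂ (g.v q (q + n) rfl).hom

/-- The cochain `1 ⊗ g`, given by `x ⊗ y ↦ (-1) ^ (|g| |x|) x ⊗ g(y)`. -/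
def tensorCochain (P : CochainComplex (ModuleCat.{u} R) ℤ) {n : ℤ} (g : Cochain X Y n) :
    Cochain (tensorObj P X) (tensorObj P Y) n :=
  Cochain.mk fun _ _ hij => ModuleCat.ofHom (tensorDesc (tensorCochainAux P hij g))

lemma evalAt_tensorCochain {n : ℤ} (g : Cochain X Y n) {p q i j q' : ℤ} (hi : p + q = i)
    (hj : i + n = j) (hq : q + n = q') (x : P.X p) (y : X.X q) :
    evalAt (tensorCochain P g) i j hj (tmul hi x y) =
      (n * p).negOnePow • (tmul (by lia) x (evalAt g q q' hq y) : (tensorObj P Y).X j) := by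
  subst hq
  have h := tensorDesc_tmul (tensorCochainAux P hj g) hi x y
  refine h.trans ?_
  rw [tensorCochainAux, Units.smul_def, Units.smul_def]
  rfl

lemma tensorCochain_add {n : ℤ} (g g' : Cochain X Y n) :
    tensorCochain P (g + g') = tensorCochain P g + tensorCochain P g' :=
  tensor_cochain_ext fun p q i j hi hj x y => by
    rw [evalAt_add, evalAt_tensorCochain _ _ _ rfl, evalAt_tensorCochain _ _ _ rfl,
      evalAt_tensorCochain _ _ _ rfl, evalAt_add, tmul_add, smul_add]

lemma tensorCochain_neg {n : ℤ} (g : Cochain X Y n) :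
    tensorCochain P (-g) = -tensorCochain P g := by
  have h0 : tensorCochain P (0 : Cochain X Y n) = 0 := by
    have := tensorCochain_add (P := P) (0 : Cochain X Y n) 0
    simpa using this
  rw [eq_neg_iff_add_eq_zero, ← tensorCochain_add, neg_add_cancel, h0]

lemma tensorCochain_zero {n : ℤ} :
    tensorCochain P (0 : Cochain X Y n) = 0 := by
  have := tensorCochain_add (P := P) (0 : Cochain X Y n) 0
  simpa using this

lemma tensorCochain_comp {n m k : ℤ} (g : Cochain X Y n) (g' : Cochain Y Z m) (h : n + m = k) :
    tensorCochain P (g.comp g' h) = (tensorCochain P g).comp (tensorCochain P g') h :=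
  tensor_cochain_ext fun p q i j hi hj x y => by
    rw [evalAt_comp _ _ _ i (i + n) j rfl (by lia), evalAt_tensorCochain g hi rfl rfl,
      evalAt_map_units_smul, evalAt_tensorCochain g' _ _ (show q + n + m = q + k by lia),
      evalAt_tensorCochain _ hi _ rfl, smul_smul, ← Int.negOnePow_add,
      evalAt_comp _ _ _ q (q + n) _ rfl (by lia), ← add_mul, h]

lemma tensorCochain_id :
    tensorCochain P (Cochain.ofHom (𝟙 X)) = Cochain.ofHom (𝟙 (tensorObj P X)) :=
  tensor_cochain_ext fun p q i j hi hj x y => by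
    obtain rfl : i = j := by lia
    rw [evalAt_tensorCochain _ _ _ (add_zero q), evalAt_ofHom, evalAt_ofHom, zero_mul,
      Int.negOnePow_zero, one_smul]
    rfl

lemma δ_tensorCochain {n m : ℤ} (g : Cochain X Y n) :
    δ n m (tensorCochain P g) = tensorCochain P (δ n m g) := by
  by_cases hnm : n + 1 = m
  swap
  · rw [δ_shape _ _ hnm, δ_shape _ _ hnm, tensorCochain_zero]
  refine tensor_cochain_ext fun p q i j hi hj x y => ?_
  subst hnm
  rw [evalAt_δ rfl _ i (i + 1) (i + n) j rfl rfl hj, evalAt_tensorCochain _ hi _ rfl,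
    evalAt_tensorCochain _ hi _ (show q + (n + 1) = q + n + 1 by lia),
    evalAt_δ rfl _ q (q + 1) (q + n) _ rfl rfl, d_tmul hi rfl rfl rfl, evalAt_map_add,
    evalAt_map_units_smul, evalAt_tensorCochain _ _ _ rfl,
    evalAt_tensorCochain _ _ _ (show q + 1 + n = q + n + 1 by lia),
    Units.smul_def (n * p).negOnePow, map_zsmul, ← Units.smul_def, d_tmul _ rfl rfl (by lia),
    tmul_add, tmul_units_smul, smul_add, smul_add, smul_add, smul_smul, smul_smul, smul_smul,
    smul_smul]
  have e1 : (n + 1).negOnePow * (n * (p + 1)).negOnePow = - (n * p).negOnePow := by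
    rw [← Int.negOnePow_add, ← Int.negOnePow_succ, Int.negOnePow_eq_iff]
    exact ⟨n, by ring⟩
  have e2 : ((n + 1) * p).negOnePow = (n * p).negOnePow * p.negOnePow := by
    rw [← Int.negOnePow_add, add_one_mul]
  have e3 : (n + 1).negOnePow * p.negOnePow * (n * p).negOnePow =
      (n * p).negOnePow * p.negOnePow * (n + 1).negOnePow := by
    rw [mul_comm (n * p).negOnePow, mul_comm, mul_comm (n + 1).negOnePow, ← mul_assoc,
      mul_comm (n * p).negOnePow]
  rw [e1, e3, e2, Units.neg_smul, smul_smul]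
  abel

/-- The chain map `1 ⊗ f`. -/
def tensorMap (P : CochainComplex (ModuleCat.{u} R) ℤ) (f : X ⟶ Y) :
    tensorObj P X ⟶ tensorObj P Y :=
  Cocycle.homOf (Cocycle.mk (tensorCochain P (Cochain.ofHom f)) 1 rfl (by
    rw [δ_tensorCochain, δ_ofHom, tensorCochain_zero]))

lemma ofHom_tensorMap (f : X ⟶ Y) :
    Cochain.ofHom (tensorMap P f) = tensorCochain P (Cochain.ofHom f) :=
  Cocycle.cochain_ofHom_homOf_eq_coe _

lemma tensorMap_tmul (f : X ⟶ Y) {p q n : ℤ} (h : p + q = n) (x : P.X p) (y : X.X q) :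
    ((tensorMap P f).f n).hom (tmul h x y) = tmul h x ((f.f q).hom y) := by
  rw [← evalAt_ofHom _ _ (add_zero n), ofHom_tensorMap, evalAt_tensorCochain _ _ _ (add_zero q),
    evalAt_ofHom, zero_mul, Int.negOnePow_zero, one_smul]

/-- Tensor products commute with mapping cones. -/
def tensorMappingConeIso (P : CochainComplex (ModuleCat.{u} R) ℤ) (f : X ⟶ Y) :
    mappingCone (tensorMap P f) ≅ tensorObj P (mappingCone f) where
  hom := mappingCone.desc _ (tensorCochain P (mappingCone.inl f)) (tensorMap P (mappingCone.inr f))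
    (by rw [δ_tensorCochain, mappingCone.δ_inl, Cochain.ofHom_comp, tensorCochain_comp,
      Cochain.ofHom_comp, ofHom_tensorMap, ofHom_tensorMap])
  inv := mappingCone.lift _
    (Cocycle.mk (tensorCochain P (mappingCone.fst f).1) 2 rfl (by
      rw [δ_tensorCochain, Cocycle.δ_eq_zero, tensorCochain_zero]))
    (tensorCochain P (mappingCone.snd f)) (by
      change _ + (tensorCochain P (mappingCone.fst f).1).comp _ _ = 0
      rw [δ_tensorCochain, mappingCone.δ_snd, ofHom_tensorMap, ← tensorCochain_comp,
        tensorCochain_neg, neg_add_cancel])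
  hom_inv_id := by
    have h {U V W : CochainComplex (ModuleCat.{u} R) ℤ} {n m k : ℤ} (z : Cochain U V n)
        (w : Cochain V W m) (a b c : ℤ) (hab : a + n = b) (hbc : b + m = c) (hk : n + m = k) :
        (tensorCochain P z).v a b hab ≫ (tensorCochain P w).v b c hbc =
        (tensorCochain P (z.comp w hk)).v a c (by lia) := by
      rw [tensorCochain_comp, Cochain.comp_v _ _ _ a b c hab hbc]
    have h' {U V : CochainComplex (ModuleCat.{u} R) ℤ} (g : U ⟶ V) (a : ℤ) :
        (tensorMap P g).f a = (tensorCochain P (Cochain.ofHom g)).v a a (add_zero a) := by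
      rw [← ofHom_tensorMap, Cochain.ofHom_v]
    ext1 n
    apply mappingCone.ext_from _ (n + 1) n rfl
    · apply mappingCone.ext_to _ n (n + 1) rfl
      · simp [h _ _ _ _ _ _ _ (show (-1 : ℤ) + 1 = 0 by lia), tensorCochain_id]
      · simp [h _ _ _ _ _ _ _ (show (-1 : ℤ) + 0 = -1 by lia), tensorCochain_zero]
    · apply mappingCone.ext_to _ n (n + 1) rfl
      · simp [h', h _ _ _ _ _ _ _ (show (0 : ℤ) + 1 = 1 by lia), tensorCochain_zero]
      · simp [h', h _ _ _ _ _ _ _ (show (0 : ℤ) + 0 = 0 by lia), tensorCochain_id]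
  inv_hom_id := by
    apply Cochain.ofHom_injective
    rw [Cochain.ofHom_comp, mappingCone.ofHom_desc, mappingCone.ofHom_lift]
    simp [mappingCone.liftCochain_descCochain, ← tensorCochain_comp, ofHom_tensorMap,
      ← tensorCochain_add, mappingCone.id, tensorCochain_id]

end Tensor

/-! ### K-projective complexes are K-flat -/

section KFlat

variable {X Y W P : CochainComplex (ModuleCat.{u} R) ℤ}

lemma acyclic_iff_of_quasiIso (f : X ⟶ Y) [QuasiIso f] : X.Acyclic ↔ Y.Acyclic :=
  forall_congr' fun i => exactAt_iff_of_quasiIsoAt f i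

/-- The complex `Hom(W, J)` for a module `J`, with `Hom(W.X (-n), J)` in degree `n`. -/
def dualComplex (W : CochainComplex (ModuleCat.{u} R) ℤ) (J : ModuleCat.{u} R) :
    CochainComplex (ModuleCat.{u} R) ℤ where
  X n := ModuleCat.of R (W.X (-n) →ₗ[R] J)
  d i j := ModuleCat.ofHom (j.negOnePow • LinearMap.lcomp R J (W.d (-j) (-i)).hom)
  shape i j hij := by
    rw [W.shape (-j) (-i) (by simp at hij ⊢; lia)]
    refine ModuleCat.hom_ext (LinearMap.ext fun g => ?_)
    change j.negOnePow • (g ∘ₗ (0 : W.X (-j) →ₗ[R] W.X (-i))) = 0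
    rw [LinearMap.comp_zero, smul_zero]
  d_comp_d' i j k _ _ := by
    refine ModuleCat.hom_ext (LinearMap.ext fun g => ?_)
    change k.negOnePow • ((j.negOnePow • (g ∘ₗ (W.d (-j) (-i)).hom)) ∘ₗ (W.d (-k) (-j)).hom) = 0
    have : (g ∘ₗ (W.d (-j) (-i)).hom) ∘ₗ (W.d (-k) (-j)).hom = 0 :=
      LinearMap.ext fun x => (congrArg g (d_d_apply W _ _ _ x)).trans (map_zero g)
    rw [Units.smul_def j.negOnePow, LinearMap.smul_comp, this, smul_zero, smul_zero]

/-- An element of the dual complex, viewed as a linear map. -/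
def dualEval {J : ModuleCat.{u} R} {n : ℤ} (g : (dualComplex W J).X n) : W.X (-n) →ₗ[R] J := g

lemma dualComplex_d_apply {J : ModuleCat.{u} R} (i j : ℤ) (g : (dualComplex W J).X i)
    (w : W.X (-j)) :
    dualEval (((dualComplex W J).d i j).hom g) w =
      j.negOnePow • dualEval g ((W.d (-j) (-i)).hom w) := rfl

lemma acyclic_dualComplex (hW : W.Acyclic) (J : ModuleCat.{u} R) [Injective J] :
    (dualComplex W J).Acyclic := by
  intro n
  rw [exactAt_iff_exists (i := n - 1) (by lia) rfl]
  intro (g : W.X (-n) →ₗ[R] J) hg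
  have hex := (W.exactAt_iff' (-(n + 1)) (-n) (-(n - 1)) (by simp; lia) (by simp; lia)).1 (hW (-n))
  have h0 : W.d (-(n + 1)) (-n) ≫ ModuleCat.ofHom g = 0 := by
    refine ModuleCat.hom_ext (LinearMap.ext fun w => ?_)
    have := LinearMap.congr_fun hg w
    exact (smul_eq_zero_iff_eq (n + 1).negOnePow).1 this
  have h1 := hex.comp_descToInjective (ModuleCat.ofHom g) h0
  refine ⟨n.negOnePow • (hex.descToInjective (ModuleCat.ofHom g) h0).hom, ?_⟩
  refine LinearMap.ext fun (w : W.X (-n)) => ?_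
  refine (dualComplex_d_apply _ _ _ w).trans ?_
  refine (smul_smul n.negOnePow n.negOnePow (_ : J)).trans ?_
  rw [Int.units_mul_self, one_smul]
  exact congrArg (fun f => f.hom w) h1

/-- Change of the degree in which a cochain with values in the dual complex is evaluated. -/
lemma apply_XIsoOfEq {J : ModuleCat.{u} R} {n p r s : ℤ} (hr : p + n = r) (hs : p + n = s)
    (e : -r = -s) (g : Cochain P (dualComplex W J) n) (x : P.X p) (w : W.X (-r)) :
    dualEval (evalAt g p s hs x) ((W.XIsoOfEq e).hom.hom w) =
      dualEval (evalAt g p r hr x) w := by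
  obtain rfl : r = s := by lia
  simp

/-- Exactness can be tested on maps to injective modules. -/
lemma exactAt_of_forall_injective {i j k : ℤ} (hij : i + 1 = j) (hjk : j + 1 = k)
    (h : ∀ (J : ModuleCat.{u} R) [Injective J] (l : X.X j →ₗ[R] J),
      (∀ w, l ((X.d i j).hom w) = 0) → ∃ l' : X.X k →ₗ[R] J, l = l' ∘ₗ (X.d j k).hom) :
    X.ExactAt j := by
  rw [exactAt_iff_exists hij hjk]
  intro z hz
  let ι := (Injective.ι (ModuleCat.of R (X.X j ⧸ LinearMap.range (X.d i j).hom))).hom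
  have hι : Function.Injective ι := (ModuleCat.mono_iff_injective _).1 inferInstance
  obtain ⟨l', hl'⟩ := h _ (ι ∘ₗ (LinearMap.range (X.d i j).hom).mkQ) fun w =>
    (congrArg ι ((Submodule.Quotient.mk_eq_zero _).2 ⟨w, rfl⟩)).trans (map_zero ι)
  have : (LinearMap.range (X.d i j).hom).mkQ z = 0 :=
    hι ((LinearMap.congr_fun hl' z).trans (((congrArg l' hz).trans (map_zero l')).trans
      (map_zero ι).symm))
  exact (Submodule.Quotient.mk_eq_zero _).1 this

/-- The tensor-Hom adjunction on a single term, from cochains to linear maps. -/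
lemma exists_linearMap_of_cochain {J : ModuleCat.{u} R} {m n : ℤ} (hmn : m + n = 0)
    (ψ : Cochain P (dualComplex W J) m) :
    ∃ Ψ : (tensorObj P W).X n →ₗ[R] J, ∀ (p q : ℤ) (h : p + m = q) (h' : p + -q = n) (x : P.X p)
      (w : W.X (-q)), Ψ (tmul h' x w) = dualEval (evalAt ψ p q h x) w := by
  refine ⟨tensorDesc fun p q h =>
    LinearMap.compl₂ (ψ.v p (-q) (by lia)).hom (W.XIsoOfEq (neg_neg q).symm).hom.hom, ?_⟩
  intro p q h h' x w
  refine (tensorDesc_tmul _ _ _ _).trans ?_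
  exact apply_XIsoOfEq h (by lia) _ _ _ _

/-- The tensor-Hom adjunction on a single term, from linear maps to cochains. -/
lemma exists_cochain_of_linearMap {J : ModuleCat.{u} R} {m n : ℤ} (hmn : m + n = 0)
    (l : (tensorObj P W).X n →ₗ[R] J) :
    ∃ φ : Cochain P (dualComplex W J) m, ∀ (p q : ℤ) (h : p + m = q) (h' : p + -q = n) (x : P.X p)
      (w : W.X (-q)), dualEval (evalAt φ p q h x) w = l (tmul h' x w) :=
  ⟨Cochain.mk fun p q hpq => ModuleCat.ofHom ((tmulBilin P W (show p + -q = n by lia)).compr₂ l),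
    fun _ _ _ _ _ _ => rfl⟩

lemma dualEval_δ {J : ModuleCat.{u} R} {m m' p p' q q' : ℤ} (hm : m + 1 = m')
    (ψ : Cochain P (dualComplex W J) m) (hp : p + 1 = p') (hq : p + m = q) (hq' : p + m' = q')
    (x : P.X p) (w : W.X (-q')) :
    dualEval (evalAt (δ m m' ψ) p q' hq' x) w =
      q'.negOnePow • dualEval (evalAt ψ p q hq x) ((W.d (-q') (-q)).hom w) +
      m'.negOnePow • dualEval (evalAt ψ p' q' (by lia) ((P.d p p').hom x)) w := by
  rw [evalAt_δ hm ψ p p' q q' hp hq hq']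
  rfl

/-- K-projective complexes are K-flat. The reason is the adjunction between tensor product and
Hom: a map from a term of `P ⊗ W` to an injective module `J` that vanishes on coboundaries
corresponds to a cocycle from `P` to the acyclic complex `Hom(W, J)`. -/
lemma acyclic_tensorObj [P.IsKProjective] (hW : W.Acyclic) : (tensorObj P W).Acyclic := by
  intro n
  refine exactAt_of_forall_injective (i := n - 1) (by lia) rfl fun J _ l hl => ?_
  obtain ⟨φ, hφ⟩ := exists_cochain_of_linearMap (neg_add_cancel n) l
  have hδ : δ (-n) (-n + 1) φ = 0 := by
    refine cochain_ext fun p q hpq x => LinearMap.ext fun (w : W.X (-q)) => ?_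
    have h0 : p + -q = n - 1 := by lia
    have h1 := hl (tmul h0 x w)
    rw [d_tmul _ rfl (show -q + 1 = -(q - 1) by lia) (by lia), map_add, Units.smul_def, map_zsmul,
      ← Units.smul_def, add_eq_zero_iff_eq_neg] at h1
    refine (dualEval_δ rfl φ rfl (show p + -n = q - 1 by lia) hpq x w).trans ?_
    rw [hφ p (q - 1) (by lia) (by lia), hφ (p + 1) q (by lia) (by lia), h1, smul_neg, smul_smul,
      ← Int.negOnePow_add, show -n + 1 + p = q by omega]
    exact add_neg_cancel _
  obtain ⟨ψ, hψ⟩ := (homComplex_exactAt_iff (i := -n - 1) (by omega) rfl).1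
    (acyclic_homComplex (P := P) (acyclic_dualComplex hW J) (-n)) φ hδ
  obtain ⟨Ψ, hΨ⟩ := exists_linearMap_of_cochain (show -n - 1 + (n + 1) = 0 by omega) ψ
  refine ⟨n.negOnePow • Ψ, tensor_linearMap_ext fun p q hpq x w => ?_⟩
  obtain ⟨r, rfl⟩ : ∃ r, q = -r := ⟨-q, (neg_neg q).symm⟩
  have hL := dualEval_δ (show -n - 1 + 1 = -n by omega) ψ rfl (show p + (-n - 1) = r - 1 by omega)
    (show p + -n = r by omega) x w
  rw [hψ, hφ _ _ _ hpq] at hL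
  have hR : Ψ (((tensorObj P W).d n (n + 1)).hom (tmul hpq x w)) =
      dualEval (evalAt ψ (p + 1) r (by omega) ((P.d p (p + 1)).hom x)) w +
      p.negOnePow • dualEval (evalAt ψ p (r - 1) (by omega) x) ((W.d (-r) (-(r - 1))).hom w) := by
    rw [d_tmul hpq rfl (show -r + 1 = -(r - 1) by omega) rfl, map_add, hΨ (p + 1) r (by omega),
      Units.smul_def p.negOnePow, map_zsmul, ← Units.smul_def, hΨ p (r - 1) (by omega)]
  refine Eq.trans ?_ (congrArg (fun a : J => n.negOnePow • a) hR).symm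
  rw [hL, smul_add, smul_smul, ← Int.negOnePow_add, Int.negOnePow_neg,
    show (n + p).negOnePow = r.negOnePow from (Int.negOnePow_eq_iff _ _).2 ⟨n, by omega⟩, add_comm]

/-- For a K-projective complex, the tensor product computes the derived tensor product. -/
lemma quasiIso_tensorMap [P.IsKProjective] {f : X ⟶ Y} (hf : QuasiIso f) :
    QuasiIso (tensorMap P f) := by
  rw [quasiIso_iff_acyclic_mappingCone] at hf ⊢
  exact (acyclic_iff_of_quasiIso (tensorMappingConeIso P f).hom).2 (acyclic_tensorObj hf)

lemma acyclic_tensorObj_mappingCone {f : X ⟶ Y} (hf : QuasiIso (tensorMap P f)) :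
    (tensorObj P (mappingCone f)).Acyclic := by
  rw [quasiIso_iff_acyclic_mappingCone] at hf
  exact (acyclic_iff_of_quasiIso (tensorMappingConeIso P f).hom).1 hf

end KFlat

/-! ### The ring as a complex -/

section RingComplex

variable {X Y W P : CochainComplex (ModuleCat.{u} R) ℤ}

lemma isKProjective_single (M : ModuleCat.{u} R) [Projective M] (s : ℤ) :
    CochainComplex.IsKProjective
      ((HomologicalComplex.single (ModuleCat.{u} R) (ComplexShape.up ℤ) s).obj M) := by
  have (n : ℤ) : Projective
      (((HomologicalComplex.single (ModuleCat.{u} R) (ComplexShape.up ℤ) s).obj M).X n) := by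
    by_cases h : n = s
    · subst h
      exact Projective.of_iso (singleObjXSelf (ComplexShape.up ℤ) n M).symm inferInstance
    · exact (isZero_single_obj_X (ComplexShape.up ℤ) s M n h).projective
  have : CochainComplex.IsStrictlyLE ((HomologicalComplex.single (ModuleCat.{u} R)
      (ComplexShape.up ℤ) s).obj M) s := by
    rw [CochainComplex.isStrictlyLE_iff]
    intro i hi
    exact isZero_single_obj_X (ComplexShape.up ℤ) s M i (by lia)
  exact isKProjective_of_projective _ s

lemma isKProjective_ringComplex : CochainComplex.IsKProjective (ringComplex R) :=
  isKProjective_single (ModuleCat.of R R) 0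

/-- The generator of the ring, viewed as a complex in degree zero. -/
def ringOne (R : Type u) [CommRing R] : (ringComplex R).X 0 :=
  (singleObjXSelf (ComplexShape.up ℤ) 0 (ModuleCat.of R R)).inv.hom (1 : R)

lemma exists_smul_ringOne (x : (ringComplex R).X 0) : ∃ r : R, x = r • ringOne R := by
  let e := singleObjXSelf (ComplexShape.up ℤ) 0 (ModuleCat.of R R)
  refine ⟨e.hom.hom x, ?_⟩
  have h1 : e.inv.hom (e.hom.hom x) = x := congrArg (fun g => g.hom x) e.hom_inv_id
  have h2 : e.inv.hom ((e.hom.hom x : R) • (1 : R)) = (e.hom.hom x : R) • e.inv.hom (1 : R) :=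
    map_smul _ _ _
  refine h1.symm.trans (Eq.trans ?_ h2)
  exact congrArg e.inv.hom (mul_one (e.hom.hom x : R)).symm

lemma smul_ringOne_eq_zero {r : R} (h : r • ringOne R = 0) : r = 0 := by
  let e := singleObjXSelf (ComplexShape.up ℤ) 0 (ModuleCat.of R R)
  have h1 : e.hom.hom (r • ringOne R) = r • e.hom.hom (ringOne R) := map_smul _ _ _
  have h2 : e.hom.hom (ringOne R) = (1 : R) :=
    congrArg (fun g => g.hom (1 : R)) e.inv_hom_id
  rw [h, map_zero, h2] at h1
  exact (mul_one r).symm.trans h1.symm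

lemma ringComplex_eq_zero {n : ℤ} (hn : n ≠ 0) (x : (ringComplex R).X n) : x = 0 := by
  have := (isZero_single_obj_X (ComplexShape.up ℤ) 0 (ModuleCat.of R R) n hn)
  exact (ModuleCat.subsingleton_of_isZero this).elim _ _

lemma ringComplex_d (i j : ℤ) (x : (ringComplex R).X i) : ((ringComplex R).d i j).hom x = 0 := by
  by_cases h : j = 0
  · by_cases h' : i = 0
    · subst h h'
      rw [(ringComplex R).shape _ _ (by simp)]
      rfl
    · rw [ringComplex_eq_zero h' x, map_zero]
  · exact ringComplex_eq_zero h _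

lemma homothety_ringOne (π : P ⟶ X) :
    ((homothety π).f 0).hom (ringOne R) = Cochain.ofHom π := by
  have h1 := congrArg (fun g => g.hom (ringOne R)) (mkHomFromSingle_f (K := homComplex P X) (j := 0)
    (ModuleCat.ofHom (LinearMap.toSpanSingleton R (Cochain P X 0) (Cochain.ofHom π)))
    (fun k _ => ModuleCat.hom_ext <| LinearMap.ext_ring <| by
      change δ 0 k ((1 : R) • Cochain.ofHom π) = 0
      rw [one_smul, δ_ofHom]))
  have h2 := congrArg (fun g => g.hom (1 : R))
    (singleObjXSelf (ComplexShape.up ℤ) 0 (ModuleCat.of R R)).inv_hom_id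
  refine h1.trans ((congrArg (LinearMap.toSpanSingleton R (Cochain P X 0)
    (Cochain.ofHom π)) h2).trans ?_)
  exact one_smul _ _

lemma ringComplex_hom_ext {f g : ringComplex R ⟶ X}
    (h : (f.f 0).hom (ringOne R) = (g.f 0).hom (ringOne R)) : f = g := by
  refine HomologicalComplex.hom_ext _ _ fun n => ?_
  by_cases hn : n = 0
  · subst hn
    refine ModuleCat.hom_ext (LinearMap.ext fun x => ?_)
    obtain ⟨r, rfl⟩ := exists_smul_ringOne x
    rw [map_smul, map_smul, h]
  · exact ModuleCat.hom_ext (LinearMap.ext fun x => by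
      rw [ringComplex_eq_zero hn x, map_zero, map_zero])

lemma homothety_comp_postcomp (f : P ⟶ X) (g : X ⟶ Y) :
    homothety f ≫ homComplexPostcomp P g = homothety (f ≫ g) := by
  refine ringComplex_hom_ext ?_
  rw [homothety_ringOne]
  refine (congrArg ((homComplexPostcomp P g).f 0).hom (homothety_ringOne f)).trans ?_
  exact (Cochain.ofHom_comp f g).symm

lemma evaluation_tmul {p q n : ℤ} (h : p + q = n) (x : X.X p) (f : Cochain X Y q) :
    ((evaluation X Y).f n).hom (tmul (Y := homComplex X Y) h x f) =
      (p * q).negOnePow • evalAt f p n h x :=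
  congrArg (fun g => g.hom (TensorProduct.tmul R x f))
    (ι_mapBifunctorDesc (K₁ := X) (K₂ := homComplex X Y) (c := ComplexShape.up ℤ)
      (F := MonoidalCategory.curriedTensor _)
      (fun p q (h : p + q = n) => evaluationAux X Y p q n h) p q h)

/-- The map `x ↦ x ⊗ 1`. -/
def tensorUnit (P : CochainComplex (ModuleCat.{u} R) ℤ) : P ⟶ tensorObj P (ringComplex R) where
  f n := ModuleCat.ofHom ((tmulBilin P (ringComplex R) (add_zero n)).flip (ringOne R))
  comm' n m hnm := by
    obtain rfl : n + 1 = m := hnm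
    refine ModuleCat.hom_ext (LinearMap.ext fun x => ?_)
    refine (d_tmul (add_zero n) rfl rfl rfl x (ringOne R)).trans ?_
    rw [ringComplex_d, tmul_zero, smul_zero, add_zero]
    rfl

lemma tensorUnit_apply (n : ℤ) (x : P.X n) :
    ((tensorUnit P).f n).hom x = tmul (add_zero n) x (ringOne R) := rfl

/-- Under `P ⊗ R = P`, the evaluation map composed with `1 ⊗ χ` is `π`, where `χ` is the homothety
of `π`. -/
lemma tensorUnit_comp_evaluation (π : P ⟶ X) :
    tensorUnit P ≫ tensorMap P (homothety π) ≫ evaluation P X = π := by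
  ext n : 1
  refine ModuleCat.hom_ext (LinearMap.ext fun x => ?_)
  refine (congrArg ((evaluation P X).f n).hom ((tensorMap_tmul (homothety π) (add_zero n) x
    (ringOne R)).trans (congrArg _ (homothety_ringOne π)))).trans ?_
  rw [evaluation_tmul, mul_zero, Int.negOnePow_zero, one_smul, evalAt_ofHom]

lemma quasiIso_tensorUnit : QuasiIso (tensorUnit P) := by
  have h (n : ℤ) : IsIso ((tensorUnit P).f n) := by
    rw [ConcreteCategory.isIso_iff_bijective]
    constructor
    · have h1 := congrArg (fun f => f.f n) (tensorUnit_comp_evaluation (𝟙 P))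
      have : Mono ((tensorUnit P).f n) := mono_of_mono_fac h1
      exact (ModuleCat.mono_iff_injective _).1 this
    · have h2 : (LinearMap.range ((tensorUnit P).f n).hom).mkQ = 0 := by
        refine tensor_linearMap_ext fun p q hpq x y => ?_
        refine (Submodule.Quotient.mk_eq_zero _).2 ?_
        by_cases hq : q = 0
        · subst hq
          obtain rfl : p = n := by lia
          obtain ⟨r, rfl⟩ := exists_smul_ringOne y
          exact ⟨r • x, by rw [tensorUnit_apply, tmul_smul, smul_tmul]⟩
        · rw [ringComplex_eq_zero hq y, tmul_zero]
          exact Submodule.zero_mem _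
      intro y
      exact (Submodule.Quotient.mk_eq_zero _).1 (LinearMap.congr_fun h2 y)
  have : IsIso (tensorUnit P) := Hom.isIso_of_components _
  infer_instance

/-- For the ring itself, the coevaluation map is a homothety. -/
lemma coevaluation_ringComplex :
    coevaluation P (ringComplex R) = homothety (tensorUnit P) := by
  refine ringComplex_hom_ext ?_
  rw [homothety_ringOne]
  refine cochain_ext fun p q hpq x => ?_
  obtain rfl : p = q := by lia
  rw [evalAt_ofHom]
  refine (evalAt_coevaluationAux (X := P) (ringOne R) p p hpq x).trans ?_
  rw [zero_mul, Int.negOnePow_zero, one_smul]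
  rfl

/-- Evaluation at the generator, `Hom(R, Y) → Y`. -/
def evalRingOne (Y : CochainComplex (ModuleCat.{u} R) ℤ) : homComplex (ringComplex R) Y ⟶ Y where
  f n := ModuleCat.ofHom
    { toFun := fun (z : Cochain (ringComplex R) Y n) => evalAt z 0 n (zero_add n) (ringOne R)
      map_add' := fun _ _ => rfl
      map_smul' := fun _ _ => rfl }
  comm' n m hnm := by
    obtain rfl : n + 1 = m := hnm
    refine ModuleCat.hom_ext (LinearMap.ext fun (z : Cochain (ringComplex R) Y n) => ?_)
    refine Eq.symm ((evalAt_δ rfl z 0 1 n (n + 1) rfl (zero_add n) (zero_add _) _).trans ?_)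
    rw [ringComplex_d, evalAt_map_zero, smul_zero, add_zero]
    rfl

lemma evalRingOne_apply (n : ℤ) (z : Cochain (ringComplex R) Y n) :
    ((evalRingOne Y).f n).hom z = evalAt z 0 n (zero_add n) (ringOne R) := rfl

lemma quasiIso_evalRingOne : QuasiIso (evalRingOne Y) := by
  have h (n : ℤ) : IsIso ((evalRingOne Y).f n) := by
    rw [ConcreteCategory.isIso_iff_bijective]
    constructor
    · intro (z : Cochain (ringComplex R) Y n) (w : Cochain (ringComplex R) Y n) hzw
      refine cochain_ext fun p q hpq x => ?_
      by_cases hp : p = 0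
      · subst hp
        obtain rfl : n = q := by lia
        obtain ⟨r, rfl⟩ := exists_smul_ringOne x
        rw [evalAt_map_smul, evalAt_map_smul]
        exact congrArg (r • ·) hzw
      · rw [ringComplex_eq_zero hp x, evalAt_map_zero, evalAt_map_zero]
    · intro y
      let e := singleObjXSelf (ComplexShape.up ℤ) 0 (ModuleCat.of R R)
      let g : (ringComplex R).X 0 ⟶ Y.X n :=
        e.hom ≫ ModuleCat.ofHom (LinearMap.toSpanSingleton R (Y.X n) y)
      refine ⟨Cochain.single g n, ?_⟩
      refine (evalRingOne_apply n _).trans ?_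
      unfold evalAt
      rw [Cochain.single_v]
      have h2 : e.hom.hom (ringOne R) = (1 : R) := congrArg (fun g => g.hom (1 : R)) e.inv_hom_id
      exact (congrArg (LinearMap.toSpanSingleton R (Y.X n) y) h2).trans (one_smul _ _)
  have : IsIso (evalRingOne Y) := Hom.isIso_of_components _
  infer_instance

end RingComplex

/-! ### Boundedness and truncation -/

section Finiteness

variable {X Y F G P : CochainComplex (ModuleCat.{u} R) ℤ}

lemma IsHomologicallyBounded.of_quasiIso (f : X ⟶ Y) [QuasiIso f] :
    IsHomologicallyBounded X ↔ IsHomologicallyBounded Y := by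
  unfold IsHomologicallyBounded
  simp only [exactAt_iff_of_quasiIsoAt f]

lemma IsHomologicallyFinite.of_quasiIso (f : X ⟶ Y) [QuasiIso f] :
    IsHomologicallyFinite X ↔ IsHomologicallyFinite Y := by
  refine and_congr (IsHomologicallyBounded.of_quasiIso f) (forall_congr' fun i => ?_)
  have e : X.homology i ≃ₗ[R] Y.homology i := (isoOfQuasiIsoAt f i).toLinearEquiv
  exact ⟨fun _ => Module.Finite.equiv e, fun _ => Module.Finite.equiv e.symm⟩

lemma mappingCone_exactAt {f : F ⟶ G} {n m : ℤ} (h : n + 1 = m) (hF : F.ExactAt m)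
    (hG : G.ExactAt n) : (mappingCone f).ExactAt n := by
  subst h
  rw [exactAt_iff_exists (i := n - 1) (by lia) rfl] at hG ⊢
  rw [exactAt_iff_exists rfl rfl] at hF
  intro x hx
  obtain ⟨h1, h2⟩ := (cone_d_eq_zero_iff rfl rfl x).1 hx
  obtain ⟨a, ha⟩ := hF _ h1
  obtain ⟨b, hb⟩ := hG (coneSnd f n x + (f.f n).hom a) (by
    rw [map_add, ← f_d_apply, ha]
    exact (add_comm _ _).trans h2)
  refine ⟨coneMk f (by lia) (-a) b, ?_⟩
  rw [d_coneMk _ rfl]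
  refine cone_ext rfl ?_ ?_
  · rw [coneFst_mk, map_neg, ha, neg_neg]
  · rw [coneSnd_mk, map_neg, hb]
    abel

lemma IsHomologicallyBounded.mappingCone {f : F ⟶ G} (hF : IsHomologicallyBounded F)
    (hG : IsHomologicallyBounded G) : IsHomologicallyBounded (mappingCone f) := by
  refine ((hF.preimage (f := fun i : ℤ => i + 1) (by simp)).union hG).subset fun i hi => ?_
  by_contra h
  simp only [Set.mem_union, Set.mem_preimage, Set.mem_ofPred_eq, not_or, not_not] at h
  exact hi (mappingCone_exactAt rfl h.1 h.2)

lemma finite_homology_mappingCone [IsNoetherianRing R] (f : F ⟶ G) (n : ℤ)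
    [Module.Finite R (F.homology (n + 1))] [Module.Finite R (G.homology n)] :
    Module.Finite R ((CochainComplex.mappingCone f).homology n) := by
  have hz (y : LinearMap.ker ((CochainComplex.mappingCone f).d n (n + 1)).hom) :
      (F.d (n + 1) (n + 1 + 1)).hom (coneFst f n (n + 1) rfl y) = 0 :=
    ((cone_d_eq_zero_iff rfl rfl y.1).1 y.2).1
  refine finite_homology_of_exact (X := G) (a := n) (a' := n - 1) (b' := n - 1) (by lia) (by lia)
    ((mappingCone.inr f).f n).hom (N := F.homology (n + 1))
    (toHomology F (n + 1) ∘ₗ ((coneFst f n (n + 1) rfl).domRestrict _).codRestrict _ hz)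
    (fun x hx => by rw [← f_d_apply, hx, map_zero])
    (fun x => ⟨((mappingCone.inr f).f (n - 1)).hom x, (f_d_apply _ _ _ _).symm⟩) ?_ ?_
  · rintro y ⟨w, hw⟩
    refine (toHomology_eq_zero_iff (i := n) rfl _).2 ⟨-coneFst f (n - 1) n (by lia) w, ?_⟩
    rw [map_neg, ← coneFst_d _ rfl, hw]
    rfl
  · intro y hy
    obtain ⟨a, ha⟩ := (toHomology_eq_zero_iff (i := n) rfl _).1 hy
    replace ha : (F.d n (n + 1)).hom a = coneFst f n (n + 1) rfl y := ha
    obtain ⟨h1, h2⟩ := (cone_d_eq_zero_iff rfl rfl y.1).1 y.2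
    refine ⟨coneSnd f n y + (f.f n).hom a, ?_, coneMk f (by lia) (-a) 0, ?_⟩
    · rw [map_add, ← f_d_apply, ha]
      exact (add_comm _ _).trans h2
    · rw [d_coneMk _ rfl, map_neg, neg_neg, map_neg, map_zero, add_zero]
      have h3 (v : G.X n) : ((mappingCone.inr f).f n).hom v = coneMk f rfl 0 v := by
        unfold coneMk
        rw [map_zero, zero_add]
      refine cone_ext rfl ?_ ?_
      · rw [map_add, h3, coneFst_mk, coneFst_mk, zero_add, ha]
      · rw [map_add, h3, coneSnd_mk, coneSnd_mk, add_neg_cancel_right]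

lemma IsHomologicallyFinite.mappingCone [IsNoetherianRing R] {f : F ⟶ G}
    (hF : IsHomologicallyFinite F) (hG : IsHomologicallyFinite G) :
    IsHomologicallyFinite (mappingCone f) :=
  ⟨hF.1.mappingCone hG.1, fun n =>
    have := hF.2 (n + 1)
    have := hG.2 n
    finite_homology_mappingCone f n⟩

lemma IsHomologicallyBounded.exists_top (hX : IsHomologicallyBounded X) (h : ¬ X.Acyclic) :
    ∃ t, ¬ X.ExactAt t ∧ ∀ j, t < j → X.ExactAt j := by
  obtain ⟨i, hi⟩ := not_forall.1 h
  obtain ⟨t, ht, hmax⟩ := Set.exists_max_image _ id hX ⟨i, hi⟩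
  exact ⟨t, ht, fun j hj => by_contra fun hj' => absurd (hmax j hj') (not_le.2 hj)⟩

lemma IsHomologicallyBounded.exists_bot (hX : IsHomologicallyBounded X) (h : ¬ X.Acyclic) :
    ∃ t, ¬ X.ExactAt t ∧ ∀ j, j < t → X.ExactAt j := by
  obtain ⟨i, hi⟩ := not_forall.1 h
  obtain ⟨t, ht, hmin⟩ := Set.exists_min_image _ id hX ⟨i, hi⟩
  exact ⟨t, ht, fun j hj => by_contra fun hj' => absurd (hmin j hj') (not_le.2 hj)⟩

lemma exists_truncLE {t : ℤ} (h : ∀ j, t < j → X.ExactAt j) :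
    ∃ (T : CochainComplex (ModuleCat.{u} R) ℤ) (ι : T ⟶ X), QuasiIso ι ∧
      ∀ j, t < j → ∀ x : T.X j, x = 0 := by
  have : X.IsLE t := (CochainComplex.isLE_iff X t).2 h
  exact ⟨X.truncLE t, X.ιTruncLE t, inferInstance, fun j hj x =>
    (ModuleCat.subsingleton_of_isZero (isZero_of_isStrictlyLE (X.truncLE t) t j hj)).elim _ _⟩

lemma exists_truncGE {t : ℤ} (h : ∀ j, j < t → X.ExactAt j) :
    ∃ (T : CochainComplex (ModuleCat.{u} R) ℤ) (π : X ⟶ T), QuasiIso π ∧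
      ∀ j, j < t → ∀ x : T.X j, x = 0 := by
  have : X.IsGE t := (CochainComplex.isGE_iff X t).2 h
  exact ⟨X.truncGE t, X.πTruncGE t, inferInstance, fun j hj x =>
    (ModuleCat.subsingleton_of_isZero (isZero_of_isStrictlyGE (X.truncGE t) t j hj)).elim _ _⟩

lemma exactAt_iff_subsingleton_homology (j : ℤ) :
    X.ExactAt j ↔ Subsingleton (X.homology j) := by
  rw [exactAt_iff_isZero_homology]
  exact ⟨ModuleCat.subsingleton_of_isZero, fun _ => ModuleCat.isZero_of_subsingleton _⟩

/-- Maps from a K-projective complex in `D^{≤ s}` to a complex in `D^{≥ b}` vanish up to homotopy in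
degrees less than `b - s`. -/
lemma exists_δ_eq_of_lt [P.IsKProjective] {s b n m : ℤ} (hP : ∀ j, s < j → P.ExactAt j)
    (hY : ∀ j, j < b → Y.ExactAt j) (hn : s + n < b) (hm : m + 1 = n) (z : Cochain P Y n)
    (hz : δ n (n + 1) z = 0) : ∃ w : Cochain P Y m, δ m n w = z := by
  obtain ⟨T, ι, hι, hT⟩ := exists_truncLE hP
  obtain ⟨U, π, hπ, hU⟩ := exists_truncGE hY
  obtain ⟨r, ⟨H⟩⟩ := exists_homotopy_lift hι (𝟙 P)
  have hH := (Cochain.equivHomotopy _ _ H).2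
  set h := (Cochain.equivHomotopy _ _ H).1
  refine ((quasiIso_iff_exists _).1 (quasiIso_homComplexPostcomp (P := P) hπ)).1 m n hm z hz
    ⟨-(n.negOnePow • h.comp (z.comp (Cochain.ofHom π) (add_zero n)) (show -1 + n = m by lia)), ?_⟩
  change δ m n (-(n.negOnePow • h.comp (z.comp (Cochain.ofHom π) (add_zero n)) _)) =
    z.comp (Cochain.ofHom π) (add_zero n)
  have hz' : δ n (n + 1) (z.comp (Cochain.ofHom π) (add_zero n)) = 0 := by
    rw [δ_comp_ofHom, hz, Cochain.zero_comp]
  -- Up to homotopy `z ≫ π` equals its restriction along `P ⟶ T ⟶ P`, which vanishes for degree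
  -- reasons.
  have hzero : (Cochain.ofHom (r ≫ ι)).comp (z.comp (Cochain.ofHom π) (add_zero n)) (zero_add n) =
      0 := by
    refine cochain_ext fun p q hpq x => ?_
    by_cases hp : s < p
    · rw [evalAt_comp _ _ _ p p q (add_zero p) hpq, evalAt_ofHom]
      change evalAt _ p q hpq ((ι.f p).hom ((r.f p).hom x)) = 0
      rw [hT p hp ((r.f p).hom x), map_zero, evalAt_map_zero]
    · exact hU q (by lia) _
  rw [hH, Cochain.add_comp, Cochain.id_comp] at hzero
  rw [δ_neg, δ_units_smul, δ_comp h _ _ 0 (n + 1) n hm rfl (by lia), hz', Cochain.comp_zero,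
    zero_add, smul_smul, Int.units_mul_self, one_smul]
  exact neg_eq_of_add_eq_zero_right hzero

end Finiteness

/-! ### Functionals to the residue field -/

section Local

variable [IsLocalRing R] {X Y F G P : CochainComplex (ModuleCat.{u} R) ℤ}

/-- Nakayama's lemma: a nonzero finite module maps onto the residue field. -/
lemma exists_residue_functional (M : Type*) [AddCommGroup M] [Module R M] [Module.Finite R M]
    [Nontrivial M] : ∃ (ψ : M →ₗ[R] R ⧸ IsLocalRing.maximalIdeal R) (x : M), ψ x ≠ 0 := by
  obtain ⟨N, hN⟩ := IsCoatomic.exists_coatom (α := Submodule R M)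
  have hs : IsSimpleModule R (M ⧸ N) := isSimpleModule_iff_isCoatom.2 hN
  obtain ⟨I, hI, ⟨e⟩⟩ := isSimpleModule_iff_quot_maximal.1 hs
  obtain rfl := IsLocalRing.eq_maximalIdeal hI
  have := IsSimpleModule.nontrivial R (M ⧸ N)
  obtain ⟨y, hy⟩ := exists_ne (0 : M ⧸ N)
  obtain ⟨x, rfl⟩ := N.mkQ_surjective y
  exact ⟨e.toLinearMap ∘ₗ N.mkQ, x, fun h => hy (e.map_eq_zero_iff.1 h)⟩

/-- The top cohomology of a complex that is zero above degree `t` is detected by a chain map to the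
residue field. -/
lemma exists_top_functional_of_strict {T : CochainComplex (ModuleCat.{u} R) ℤ} {t : ℤ}
    (hT : ∀ j, t < j → ∀ x : T.X j, x = 0) (ht : ¬ T.ExactAt t) [Module.Finite R (T.homology t)] :
    ∃ (c : T.X t) (φ : T.X t →ₗ[R] R ⧸ IsLocalRing.maximalIdeal R),
      (∀ i (w : T.X i), φ ((T.d i t).hom w) = 0) ∧ φ c ≠ 0 := by
  have : Nontrivial (T.homology t) := by
    rwa [← not_subsingleton_iff_nontrivial, ← exactAt_iff_subsingleton_homology]
  obtain ⟨ψ, h, hψ⟩ := exists_residue_functional (R := R) (T.homology t)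
  have hz (x : T.X t) : (T.d t (t + 1)).hom x = 0 := hT _ (by lia) _
  obtain ⟨⟨c, hc⟩, rfl⟩ := toHomology_surjective T t h
  refine ⟨c, ψ ∘ₗ toHomology T t ∘ₗ LinearMap.id.codRestrict _ hz, fun i w => ?_, hψ⟩
  by_cases hi : i + 1 = t
  · exact (congrArg ψ ((toHomology_eq_zero_iff hi _).2 ⟨w, rfl⟩)).trans (map_zero ψ)
  · rw [T.shape i t hi]
    exact map_zero _

/-- The top cohomology of a K-projective complex is detected by a chain map to the residue field.
K-projectivity gives a homotopy inverse to the inclusion of the truncation. -/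
lemma exists_top_functional [P.IsKProjective] {t : ℤ}
    (hP : ∀ j, t < j → P.ExactAt j) (ht : ¬ P.ExactAt t) [Module.Finite R (P.homology t)] :
    ∃ (c : P.X t) (φ : P.X t →ₗ[R] R ⧸ IsLocalRing.maximalIdeal R),
      (P.d t (t + 1)).hom c = 0 ∧ (∀ i (w : P.X i), φ ((P.d i t).hom w) = 0) ∧ φ c ≠ 0 := by
  obtain ⟨T, ι, hι, hT⟩ := exists_truncLE hP
  obtain ⟨r, ⟨H⟩⟩ := exists_homotopy_lift hι (𝟙 P)
  have hfin : Module.Finite R (T.homology t) :=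
    Module.Finite.equiv (isoOfQuasiIsoAt ι t).toLinearEquiv.symm
  obtain ⟨c, φ, hφ, hc⟩ := exists_top_functional_of_strict hT
    (fun h => ht ((exactAt_iff_of_quasiIsoAt ι t).1 h))
  have hdc : (T.d t (t + 1)).hom c = 0 := hT _ (by lia) _
  refine ⟨(ι.f t).hom c, φ ∘ₗ (r.f t).hom, ?_, fun i w => ?_, ?_⟩
  · rw [← f_d_apply, hdc, map_zero]
  · rw [LinearMap.comp_apply, f_d_apply, hφ]
  · have hH := (Cochain.equivHomotopy _ _ H).2
    set h := (Cochain.equivHomotopy _ _ H).1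
    have h1 := congrArg (fun z => evalAt z t t (add_zero t) ((ι.f t).hom c)) hH
    beta_reduce at h1
    rw [evalAt_add, evalAt_δ (by lia) h t (t + 1) (t - 1) t rfl (by lia) (by lia), ← f_d_apply, hdc,
      map_zero, evalAt_map_zero, smul_zero, add_zero, evalAt_ofHom, evalAt_ofHom] at h1
    replace h1 : (ι.f t).hom ((r.f t).hom ((ι.f t).hom c)) =
      (P.d (t - 1) t).hom (evalAt h t (t - 1) (by lia) ((ι.f t).hom c)) + (ι.f t).hom c := h1
    obtain ⟨w, hw⟩ := ((quasiIso_iff_exists ι).1 hι).1 (t - 1) t (by lia)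
      ((r.f t).hom ((ι.f t).hom c) - c) (hT _ (by lia) _)
      ⟨evalAt h t (t - 1) (by omega) ((ι.f t).hom c), by
        rw [map_sub (ι.f t).hom, h1, add_sub_cancel_right]⟩
    rw [LinearMap.comp_apply]
    rw [eq_sub_iff_add_eq] at hw
    rwa [← hw, map_add, hφ, zero_add]

end Local

/-! ### Finite generation of the cohomology of Hom complexes -/

section FiniteHom

variable {X Y F G P : CochainComplex (ModuleCat.{u} R) ℤ}

lemma evalAt_δ_of_d_eq_zero {n m : ℤ} (hnm : n + 1 = m) (z : Cochain X Y n) {p q q' : ℤ}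
    (hq : p + n = q) (hq' : p + m = q') {x : X.X p} (hx : (X.d p (p + 1)).hom x = 0) :
    evalAt (δ n m z) p q' hq' x = (Y.d q q').hom (evalAt z p q hq x) := by
  rw [evalAt_δ hnm z p (p + 1) q q' rfl hq hq', hx, evalAt_map_zero, smul_zero, add_zero]

/-- Let `F` be a projective module placed in degree `s`. A cochain from `F` to `Y` is a coboundary
if all its values are. -/
lemma exists_δ_eq_of_concentrated {s m n i q : ℤ} (hF : ∀ j, j ≠ s → ∀ x : F.X j, x = 0)
    [Module.Projective R (F.X s)] (z : Cochain F Y n) (hm : m + 1 = n) (hi : i + 1 = q)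
    (hq : s + n = q) (hz : ∀ x, ∃ y, (Y.d i q).hom y = evalAt z s q hq x) :
    ∃ w : Cochain F Y m, δ m n w = z := by
  obtain ⟨v, hv⟩ := Module.projective_lifting_property (Y.d i q).hom.rangeRestrict
    ((z.v s q hq).hom.codRestrict _ hz) (LinearMap.surjective_rangeRestrict _)
  refine ⟨Cochain.single (ModuleCat.ofHom v) m, cochain_ext fun p q' hpq x => ?_⟩
  by_cases hp : p = s
  · subst hp
    obtain rfl : q = q' := by omega
    rw [evalAt_δ hm _ p (p + 1) i q rfl (by omega) hpq, hF (p + 1) (by omega) ((F.d _ _).hom x),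
      evalAt_map_zero, smul_zero, add_zero]
    have h1 : evalAt (Cochain.single (L := Y) (ModuleCat.ofHom v) m) p i (by omega) x = v x := by
      unfold evalAt
      rw [Cochain.single_v]
      rfl
    rw [h1]
    exact congrArg Subtype.val (LinearMap.congr_fun hv x)
  · rw [hF p hp x, evalAt_map_zero, evalAt_map_zero]

/-- Let `F` be a finite projective module placed in degree `s`, and `f : F ⟶ P`. Up to submodules
and quotients, the cohomology of `Hom(P, Y)` is built from that of `Hom(cone f, Y)` and from
`Hom(F, H(Y))`. -/
lemma finite_homology_homComplex_of_mappingCone [IsNoetherianRing R] {s n : ℤ}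
    (hF : ∀ j, j ≠ s → ∀ x : F.X j, x = 0) [Module.Projective R (F.X s)] [Module.Finite R (F.X s)]
    (f : F ⟶ P) [Module.Finite R (Y.homology (s + n))]
    [Module.Finite R ((homComplex (mappingCone f) Y).homology n)] :
    Module.Finite R ((homComplex P Y).homology n) := by
  have hd (x : F.X s) : (P.d s (s + 1)).hom ((f.f s).hom x) = 0 := by
    rw [← f_d_apply, hF (s + 1) (by omega) ((F.d _ _).hom x), map_zero]
  have hcoc (z : LinearMap.ker ((homComplex P Y).d n (n + 1)).hom) (x : F.X s) :
      (Y.d (s + n) (s + n + 1)).hom (evalAt z.1 s (s + n) rfl ((f.f s).hom x)) = 0 := by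
    have h1 : δ n (n + 1) (z.1 : Cochain P Y n) = 0 := z.2
    exact (evalAt_δ_of_d_eq_zero rfl (z.1 : Cochain P Y n) rfl (by omega) (hd x)).symm.trans
      (congrArg (fun u => evalAt u s _ _ _) h1)
  let g : LinearMap.ker ((homComplex P Y).d n (n + 1)).hom →ₗ[R]
      (F.X s →ₗ[R] Y.homology (s + n)) :=
    { toFun := fun z => toHomology Y (s + n) ∘ₗ
        (((z.1 : Cochain P Y n).v s (s + n) rfl).hom ∘ₗ (f.f s).hom).codRestrict _ (hcoc z)
      map_add' := fun z z' => LinearMap.ext fun x => by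
        rw [LinearMap.add_apply, LinearMap.comp_apply, LinearMap.comp_apply, LinearMap.comp_apply,
          ← map_add]
        rfl
      map_smul' := fun r z => LinearMap.ext fun x => by
        rw [LinearMap.smul_apply, LinearMap.comp_apply, LinearMap.comp_apply, RingHom.id_apply,
          ← map_smul]
        rfl }
  refine finite_homology_of_exact (X := homComplex (mappingCone f) Y) (a := n) (a' := n - 1)
    (b' := n - 1) (by omega) (by omega) ((homComplexPrecomp (mappingCone.inr f) Y).f n).hom g
    (fun x hx => by rw [← f_d_apply, hx, map_zero])
    (fun x => ⟨((homComplexPrecomp (mappingCone.inr f) Y).f (n - 1)).hom x,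
      (f_d_apply _ _ _ _).symm⟩) ?_ ?_
  · rintro z ⟨w, hw⟩
    replace hw : δ (n - 1) n (w : Cochain P Y (n - 1)) = z.1 := hw
    refine LinearMap.ext fun x => (toHomology_eq_zero_iff (i := s + n - 1) (by omega) _).2
      ⟨evalAt (w : Cochain P Y (n - 1)) s (s + n - 1) (by omega) ((f.f s).hom x), ?_⟩
    exact (evalAt_δ_of_d_eq_zero (by omega) (w : Cochain P Y (n - 1)) _ rfl (hd x)).symm.trans
      (congrArg (fun u => evalAt u s (s + n) rfl ((f.f s).hom x)) hw)
  · rintro ⟨(z : Cochain P Y n), hz⟩ hgz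
    replace hz : δ n (n + 1) z = 0 := hz
    obtain ⟨w, hw⟩ := exists_δ_eq_of_concentrated (m := n - 1) (i := s + n - 1) hF
      ((Cochain.ofHom f).comp z (zero_add n)) (by omega) (by omega) rfl (fun x => by
        rw [evalAt_comp _ _ _ s s (s + n) (add_zero s) rfl, evalAt_ofHom]
        exact (toHomology_eq_zero_iff (i := s + n - 1) (by omega) _).1
          (LinearMap.congr_fun hgz x))
    refine ⟨mappingCone.descCochain f (-((n + 1).negOnePow • w)) z (by omega), ?_, 0, ?_⟩
    · change δ n (n + 1) (mappingCone.descCochain f _ z _) = 0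
      rw [mappingCone.δ_descCochain _ _ _ _ _ rfl, hz, δ_neg, δ_units_smul, hw, neg_add_cancel,
        Cochain.comp_zero, Cochain.comp_zero, add_zero]
    · rw [map_zero, add_zero]
      exact (mappingCone.inr_descCochain _ _ _ _).symm

/-- The top cohomology of a complex is covered by a finite free module. -/
lemma exists_free_cover (s : ℤ) [Module.Finite R (P.homology s)] :
    ∃ (F : CochainComplex (ModuleCat.{u} R) ℤ) (f : F ⟶ P), F.IsKProjective ∧
      (∀ j, j ≠ s → ∀ x : F.X j, x = 0) ∧ Module.Projective R (F.X s) ∧ Module.Finite R (F.X s) ∧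
      ∀ y, (P.d s (s + 1)).hom y = 0 →
        ∃ (x : F.X s) (w : P.X (s - 1)), (f.f s).hom x + (P.d (s - 1) s).hom w = y := by
  obtain ⟨m, φ, hφ⟩ := Module.Finite.exists_fin' R (P.homology s)
  obtain ⟨γ, hγ⟩ := Module.projective_lifting_property (toHomology P s) φ
    (toHomology_surjective P s)
  let M := ModuleCat.of R (Fin m → R)
  have hM : Projective M := (IsProjective.iff_projective (R := R) (Fin m → R)).1 inferInstance
  let e := singleObjXSelf (ComplexShape.up ℤ) s M
  refine ⟨(HomologicalComplex.single _ (ComplexShape.up ℤ) s).obj M,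
    mkHomFromSingle (K := P) (A := M) (ModuleCat.ofHom (Submodule.subtype _ ∘ₗ γ)) (fun k hk => by
      obtain rfl : s + 1 = k := hk
      exact ModuleCat.hom_ext (LinearMap.ext fun x => (γ x).2)),
    isKProjective_single M s, fun j hj x =>
      (ModuleCat.subsingleton_of_isZero
        (isZero_single_obj_X (ComplexShape.up ℤ) s M j hj)).elim _ _,
    Module.Projective.of_equiv e.toLinearEquiv.symm,
    Module.Finite.equiv e.toLinearEquiv.symm, fun y hy => ?_⟩
  obtain ⟨v, hv⟩ := hφ (toHomology P s ⟨y, hy⟩)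
  rw [← hγ, LinearMap.comp_apply, eq_comm, ← sub_eq_zero, ← map_sub,
    toHomology_eq_zero_iff (i := s - 1) (by omega)] at hv
  obtain ⟨w, hw⟩ := hv
  refine ⟨e.inv.hom v, w, ?_⟩
  rw [mkHomFromSingle_f, hw]
  have h1 : e.hom.hom (e.inv.hom v) = v := congrArg (fun g => g.hom v) e.inv_hom_id
  refine (congrArg (fun t => (γ t).1 + (y - (γ v).1)) h1).trans ?_
  exact add_sub_cancel _ _

lemma exactAt_of_forall_eq_zero {j : ℤ} (h : ∀ x : X.X j, x = 0) : X.ExactAt j := by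
  rw [exactAt_iff_exists (i := j - 1) (by omega) rfl]
  exact fun x _ => ⟨0, by rw [map_zero, h x]⟩

lemma finite_homology_of_finite [IsNoetherianRing R] (j : ℤ) [Module.Finite R (X.X j)] :
    Module.Finite R (X.homology j) :=
  Module.Finite.of_surjective (toHomology X j) (toHomology_surjective X j)

/-- Let `P` be a K-projective complex with finitely generated cohomology, bounded above, and let
`Y` be a complex with finitely generated cohomology, bounded below. Then the cohomology of
`Hom(P, Y)` is finitely generated. The top cohomology of `P` is removed by passing to the cone of
a map from a finite free module, until only degrees remain in which all maps are
null-homotopic. -/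
lemma finite_homology_homComplex_aux [IsNoetherianRing R] {b : ℤ} (hY : ∀ j, j < b → Y.ExactAt j)
    (hYf : ∀ j, Module.Finite R (Y.homology j)) (k : ℕ) :
    ∀ (P : CochainComplex (ModuleCat.{u} R) ℤ) (s n : ℤ), P.IsKProjective →
      (∀ j, s < j → P.ExactAt j) → (∀ j, Module.Finite R (P.homology j)) → s + n < b + k →
      Module.Finite R ((homComplex P Y).homology n) := by
  induction k with
  | zero =>
    intro P s n hK hP _ hn
    have : (homComplex P Y).ExactAt n :=
      (homComplex_exactAt_iff (i := n - 1) (by omega) rfl).2 fun z hz =>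
        exists_δ_eq_of_lt hP hY (by simpa using hn) (by omega) z hz
    have := (exactAt_iff_subsingleton_homology n).1 this
    infer_instance
  | succ k ih =>
    intro P s n hK hP hPf hn
    have := hPf s
    obtain ⟨F, f, hFK, hF, hproj, hfin, hcov⟩ := exists_free_cover (P := P) s
    have := hYf (s + n)
    have hFf (j : ℤ) : Module.Finite R (F.homology j) := by
      by_cases hj : j = s
      · subst hj
        exact finite_homology_of_finite j
      · have := (exactAt_iff_subsingleton_homology j).1 (exactAt_of_forall_eq_zero (hF j hj))
        infer_instance
    have hD := ih (mappingCone f) (s - 1) n (isKProjective_mappingCone hFK hK) (fun j hj => by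
      by_cases hjs : j = s
      · subst hjs
        rw [exactAt_iff_exists (i := j - 1) (by omega) rfl]
        intro x hx
        obtain ⟨-, h2⟩ := (cone_d_eq_zero_iff rfl rfl x).1 hx
        have h0 : coneFst f j (j + 1) rfl x = 0 := hF _ (by omega) _
        rw [h0, map_zero, zero_add] at h2
        obtain ⟨a, w, haw⟩ := hcov _ h2
        refine ⟨coneMk f (by omega) a w, ?_⟩
        rw [d_coneMk _ rfl]
        refine cone_ext rfl ?_ ?_
        · rw [coneFst_mk, h0]
          exact hF _ (by omega) _
        · rw [coneSnd_mk, haw]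
      · exact mappingCone_exactAt rfl (exactAt_of_forall_eq_zero (hF _ (by omega)))
          (hP j (by omega)))
      (fun j => by
        have := hFf (j + 1)
        have := hPf j
        exact finite_homology_mappingCone f j)
      (by push_cast at hn; omega)
    exact finite_homology_homComplex_of_mappingCone hF f

lemma finite_homology_homComplex [IsNoetherianRing R] [P.IsKProjective]
    (hP : IsHomologicallyFinite P) (hY : IsHomologicallyFinite Y) (n : ℤ) :
    Module.Finite R ((homComplex P Y).homology n) := by
  obtain ⟨s, hs⟩ : ∃ s : ℤ, ∀ j, s < j → P.ExactAt j := by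
    obtain ⟨s, hs⟩ := hP.1.bddAbove
    exact ⟨s, fun j hj => by_contra fun h => absurd (hs h) (not_le.2 hj)⟩
  obtain ⟨b, hb⟩ : ∃ b : ℤ, ∀ j, j < b → Y.ExactAt j := by
    obtain ⟨b, hb⟩ := hY.1.bddBelow
    exact ⟨b, fun j hj => by_contra fun h => absurd (hb h) (not_le.2 hj)⟩
  exact finite_homology_homComplex_aux hb hY.2 (s + n - b + 1).toNat P s n inferInstance hs hP.2
    (by omega)

end FiniteHom

/-! ### Nonvanishing of derived Hom -/

section Koszul

variable {Y F G C : CochainComplex (ModuleCat.{u} R) ℤ}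

lemma acyclic_homComplex_to_mappingCone {f : F ⟶ G} (hF : (homComplex C F).Acyclic)
    (hG : (homComplex C G).Acyclic) : (homComplex C (mappingCone f)).Acyclic := by
  intro n
  rw [homComplex_exactAt_iff (i := n - 1) (by omega) rfl]
  intro z hz
  obtain ⟨a, ha⟩ := (homComplex_exactAt_iff rfl rfl).1 (hF (n + 1))
    (z.comp (mappingCone.fst f).1 rfl) (by
      rw [δ_comp z (mappingCone.fst f).1 _ (n + 1) 2 (n + 1 + 1) rfl rfl rfl, hz]
      simp)
  obtain ⟨b, hb⟩ := (homComplex_exactAt_iff (i := n - 1) (by omega) rfl).1 (hG n)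
    (z.comp (mappingCone.snd f) (add_zero n) + a.comp (Cochain.ofHom f) (add_zero n)) (by
      rw [δ_add, δ_comp_ofHom, ha, δ_comp_zero_cochain _ _ _ rfl, hz]
      simp)
  refine ⟨mappingCone.liftCochain f (-a) b (by omega), ?_⟩
  rw [mappingCone.δ_liftCochain _ _ _ _ (n + 1) rfl, δ_neg, ha, hb,
    mappingCone.ext_cochain_to_iff f n (n + 1) rfl]
  constructor <;> simp

lemma smul_homology_mappingCone_smul (x : R) (n : ℤ)
    (h : (mappingCone (x • 𝟙 Y)).homology n) : x • h = 0 := by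
  obtain ⟨⟨c, hc⟩, rfl⟩ := toHomology_surjective _ n h
  rw [← map_smul, toHomology_eq_zero_iff (i := n - 1) (by omega)]
  obtain ⟨-, h2⟩ := (cone_d_eq_zero_iff rfl rfl c).1 hc
  refine ⟨coneMk _ (by omega) (coneSnd _ n c) 0, ?_⟩
  rw [d_coneMk _ rfl]
  change _ = x • c
  refine cone_ext rfl ?_ ?_
  · rw [coneFst_mk, map_smul]
    exact neg_eq_of_add_eq_zero_left h2
  · rw [coneSnd_mk, map_smul, map_zero, add_zero]
    rfl

lemma pow_smul_homology_mappingCone {f : F ⟶ G} {x : R} {N : ℕ}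
    (hF : ∀ n (h : F.homology n), x ^ N • h = 0) (hG : ∀ n (h : G.homology n), x ^ N • h = 0)
    (n : ℤ) (h : (mappingCone f).homology n) : x ^ (N + N) • h = 0 := by
  obtain ⟨⟨c, hc⟩, rfl⟩ := toHomology_surjective _ n h
  rw [← map_smul, toHomology_eq_zero_iff (i := n - 1) (by omega)]
  obtain ⟨h1, h2⟩ := (cone_d_eq_zero_iff rfl rfl c).1 hc
  have hu := hF (n + 1) (toHomology _ _ ⟨_, h1⟩)
  rw [← map_smul, toHomology_eq_zero_iff (i := n) rfl] at hu
  obtain ⟨a, ha⟩ := hu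
  replace ha : (F.d n (n + 1)).hom a = x ^ N • coneFst f n (n + 1) rfl c := ha
  have hcoc : (G.d n (n + 1)).hom (x ^ N • coneSnd f n c + (f.f n).hom a) = 0 := by
    rw [map_add, ← f_d_apply, ha, map_smul, map_smul, ← smul_add]
    exact (congrArg (x ^ N • ·) ((add_comm _ _).trans h2)).trans (smul_zero _)
  have hv := hG n (toHomology _ _ ⟨_, hcoc⟩)
  rw [← map_smul, toHomology_eq_zero_iff (i := n - 1) (by omega)] at hv
  obtain ⟨b, hb⟩ := hv
  replace hb : (G.d (n - 1) n).hom b = x ^ N • (x ^ N • coneSnd f n c + (f.f n).hom a) := hb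
  refine ⟨coneMk f (by omega) (-(x ^ N • a)) b, ?_⟩
  rw [d_coneMk _ rfl]
  change _ = x ^ (N + N) • c
  refine cone_ext rfl ?_ ?_
  · rw [coneFst_mk, map_neg, map_smul, ha, map_smul, neg_neg, smul_smul, pow_add]
  · rw [coneSnd_mk, map_neg, map_smul, hb, map_smul, smul_add, smul_smul, pow_add]
    abel

variable [IsLocalRing R]

/-- Nakayama's lemma for the cone of multiplication by a non-unit. -/
lemma not_acyclic_mappingCone_smul (hY : ∀ n, Module.Finite R (Y.homology n)) (h : ¬ Y.Acyclic)
    {x : R} (hx : x ∈ IsLocalRing.maximalIdeal R) : ¬ (mappingCone (x • 𝟙 Y)).Acyclic := by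
  intro hac
  have hq := quasiIso_iff_acyclic_mappingCone.2 hac
  refine h fun i => ?_
  rw [exactAt_iff_subsingleton_homology, ← Submodule.subsingleton_iff R,
    ← subsingleton_iff_bot_eq_top, eq_comm]
  have := hY i
  refine Submodule.eq_bot_of_le_smul_of_le_jacobson_bot (IsLocalRing.maximalIdeal R) ⊤
    Module.Finite.fg_top ?_ (IsLocalRing.maximalIdeal_le_jacobson _)
  rintro c -
  obtain ⟨⟨y, hy⟩, rfl⟩ := toHomology_surjective _ i c
  obtain ⟨u, hu, v, hv⟩ := ((quasiIso_iff_exists _).1 hq).2 (i - 1) i (by omega) y hy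
  have h1 : toHomology Y i ⟨y, hy⟩ = x • toHomology Y i ⟨u, hu⟩ := by
    rw [← map_smul, ← sub_eq_zero, ← map_sub, toHomology_eq_zero_iff (i := i - 1) (by omega)]
    exact ⟨v, (sub_eq_of_eq_add' hv).symm⟩
  rw [h1]
  exact Submodule.smul_mem_smul hx trivial

/-- The Koszul construction: the target `Y` can be replaced by a complex on whose cohomology the
given elements of the maximal ideal act nilpotently. -/
lemma exists_smul_eq_zero_of_acyclic_homComplex [IsNoetherianRing R]
    (hY : IsHomologicallyFinite Y) (hY' : ¬ Y.Acyclic) (h : (homComplex C Y).Acyclic)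
    (S : Finset R) (hS : ∀ x ∈ S, x ∈ IsLocalRing.maximalIdeal R) :
    ∃ Z : CochainComplex (ModuleCat.{u} R) ℤ, IsHomologicallyFinite Z ∧ ¬ Z.Acyclic ∧
      (homComplex C Z).Acyclic ∧ ∀ x ∈ S, ∃ N : ℕ, ∀ n (a : Z.homology n), x ^ N • a = 0 := by
  classical
  induction S using Finset.induction_on with
  | empty => exact ⟨Y, hY, hY', h, fun x hx => absurd hx (Finset.notMem_empty x)⟩
  | insert x S _ ih =>
    obtain ⟨Z, hZ, hZ', hCZ, hnil⟩ := ih fun y hy => hS y (Finset.mem_insert_of_mem hy)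
    refine ⟨mappingCone (x • 𝟙 Z), hZ.mappingCone hZ,
      not_acyclic_mappingCone_smul hZ.2 hZ' (hS x (Finset.mem_insert_self x S)),
      acyclic_homComplex_to_mappingCone hCZ hCZ, fun y hy => ?_⟩
    obtain rfl | hy := Finset.mem_insert.1 hy
    · exact ⟨1, fun n a => by rw [pow_one, smul_homology_mappingCone_smul]⟩
    · obtain ⟨N, hN⟩ := hnil y hy
      exact ⟨N + N, pow_smul_homology_mappingCone hN hN⟩

/-- An associated prime of a module on which generators of the maximal ideal act nilpotently is the
maximal ideal. -/
lemma exists_smul_eq_zero_of_nilpotent [IsNoetherianRing R] {M : Type*} [AddCommGroup M]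
    [Module R M] [Nontrivial M] {S : Set R} (hS : Ideal.span S = IsLocalRing.maximalIdeal R)
    (hM : ∀ x ∈ S, ∃ N : ℕ, ∀ a : M, x ^ N • a = 0) :
    ∃ a : M, a ≠ 0 ∧ ∀ r ∈ IsLocalRing.maximalIdeal R, r • a = 0 := by
  obtain ⟨I, hI⟩ := associatedPrimes.nonempty R M
  obtain ⟨hprime, a, ha⟩ := isAssociatedPrime_iff.1 hI
  have hmem (r : R) : r ∈ I ↔ r • a = 0 := by
    rw [ha]
    simp [Submodule.mem_colon_singleton]
  refine ⟨a, fun h0 => hprime.ne_top ?_, fun r hr => (hmem r).1 ?_⟩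
  · rw [Ideal.eq_top_iff_one, hmem, h0, smul_zero]
  · rw [← hS] at hr
    refine Ideal.span_le.2 (fun x hx => ?_) hr
    obtain ⟨N, hN⟩ := hM x hx
    exact hprime.mem_of_pow_mem N ((hmem _).2 (hN a))

/-- Derived Hom from a finite complex to a nonzero finite complex detects vanishing. After replacing
the target by a Koszul complex on generators of the maximal ideal, its lowest cohomology contains a
copy of the residue field, to which the top cohomology of the source maps. -/
theorem acyclic_of_acyclic_homComplex [IsNoetherianRing R] [C.IsKProjective]
    (hC : IsHomologicallyFinite C) (hY : IsHomologicallyFinite Y) (hY' : ¬ Y.Acyclic)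
    (h : (homComplex C Y).Acyclic) : C.Acyclic := by
  by_contra hCac
  obtain ⟨S, hS⟩ := IsNoetherian.noetherian (IsLocalRing.maximalIdeal R)
  obtain ⟨Z, hZ, hZ', hCZ, hnil⟩ := exists_smul_eq_zero_of_acyclic_homComplex hY hY' h S
    (fun x hx => hS ▸ Submodule.subset_span hx)
  obtain ⟨t, ht, hbot⟩ := hZ.1.exists_bot hZ'
  obtain ⟨T, π, hπ, hT⟩ := exists_truncGE hbot
  have e : Z.homology t ≃ₗ[R] T.homology t := (isoOfQuasiIsoAt π t).toLinearEquiv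
  have hCT : (homComplex C T).Acyclic :=
    have := quasiIso_homComplexPostcomp (P := C) hπ
    (acyclic_iff_of_quasiIso (homComplexPostcomp C π)).1 hCZ
  have : Nontrivial (T.homology t) := by
    rw [← not_subsingleton_iff_nontrivial, ← exactAt_iff_subsingleton_homology,
      ← exactAt_iff_of_quasiIsoAt π t]
    exact ht
  obtain ⟨a, ha0, ha⟩ := exists_smul_eq_zero_of_nilpotent (M := T.homology t) hS fun x hx => by
    obtain ⟨N, hN⟩ := hnil x hx
    exact ⟨N, fun a => e.symm.injective (by rw [map_smul, hN, map_zero])⟩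
  obtain ⟨⟨y, hy⟩, rfl⟩ := toHomology_surjective T t a
  have hm (r : R) (hr : r ∈ IsLocalRing.maximalIdeal R) : r • y = 0 := by
    have h1 := ha r hr
    rw [← map_smul, toHomology_eq_zero_iff (i := t - 1) (by omega)] at h1
    obtain ⟨w, hw⟩ := h1
    rw [hT _ (by omega) w, map_zero] at hw
    exact hw.symm
  obtain ⟨ψ, hψ⟩ : ∃ ψ : R ⧸ IsLocalRing.maximalIdeal R →ₗ[R] T.X t,
      ∀ r : R, ψ (Submodule.Quotient.mk r) = r • y :=
    ⟨Submodule.liftQ _ (LinearMap.toSpanSingleton R (T.X t) y) hm, fun _ => rfl⟩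
  obtain ⟨s, hs, htop⟩ := hC.1.exists_top hCac
  have := hC.2 s
  obtain ⟨c, φ, hc, hφ, hφc⟩ := exists_top_functional htop hs
  -- The cocycle `C.X s ⟶ R ⧸ 𝔪 ⟶ T.X t` is not a coboundary, since `T` vanishes below degree `t`.
  let g : C.X s ⟶ T.X t := ModuleCat.ofHom (ψ ∘ₗ φ)
  have hdg (v : R ⧸ IsLocalRing.maximalIdeal R) : (T.d t (t + 1)).hom (ψ v) = 0 := by
    obtain ⟨r, rfl⟩ := Submodule.Quotient.mk_surjective _ v
    rw [hψ, map_smul, hy, smul_zero]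
  obtain ⟨w, hw⟩ := (homComplex_exactAt_iff (i := t - s - 1) (by omega) rfl).1 (hCT (t - s))
    (Cochain.single g (t - s)) (by
      rw [Cochain.δ_single _ _ _ rfl (s - 1) (t + 1) (by omega) rfl]
      have h1 : g ≫ T.d t (t + 1) = 0 := ModuleCat.hom_ext (LinearMap.ext fun x => hdg (φ x))
      have h2 : C.d (s - 1) s ≫ g = 0 := ModuleCat.hom_ext (LinearMap.ext fun x =>
        (congrArg ψ (hφ (s - 1) x)).trans (map_zero _))
      rw [h1, h2, Cochain.single_zero, Cochain.single_zero, smul_zero, add_zero])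
  have h3 := evalAt_δ_of_d_eq_zero (show t - s - 1 + 1 = t - s by omega) w
    (show s + (t - s - 1) = t - 1 by omega) (show s + (t - s) = t by omega) hc
  rw [hT _ (by omega) (evalAt w s (t - 1) _ c), map_zero, hw] at h3
  unfold evalAt at h3
  rw [Cochain.single_v] at h3
  replace h3 : ψ (φ c) = 0 := h3
  obtain ⟨r, hr⟩ := Submodule.Quotient.mk_surjective _ (φ c)
  rw [← hr, hψ] at h3
  have hru : IsUnit r := by
    by_contra hru
    exact hφc (hr.symm.trans ((Submodule.Quotient.mk_eq_zero _).2
      ((IsLocalRing.mem_maximalIdeal r).2 hru)))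
  have hy0 : y = 0 := (hru.smul_eq_zero).1 h3
  subst hy0
  exact ha0 (map_zero _)

end Koszul

/-! ### Nonvanishing of derived tensor products -/

section TensorVanishing

variable {X Y P C : CochainComplex (ModuleCat.{u} R) ℤ}

/-- Extension by zero of a functional in one degree to all degrees. -/
def extendFunctional {s : ℤ} {M : Type*} [AddCommGroup M] [Module R M] (φ : X.X s →ₗ[R] M)
    (p : ℤ) : X.X p →ₗ[R] M :=
  if h : p = s then φ ∘ₗ (X.XIsoOfEq h).hom.hom else 0

lemma extendFunctional_self {s : ℤ} {M : Type*} [AddCommGroup M] [Module R M]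
    (φ : X.X s →ₗ[R] M) : extendFunctional φ s = φ := by
  unfold extendFunctional
  rw [dif_pos rfl, XIsoOfEq_rfl]
  rfl

lemma extendFunctional_d {s : ℤ} {M : Type*} [AddCommGroup M] [Module R M] {φ : X.X s →ₗ[R] M}
    (h : ∀ i (w : X.X i), φ ((X.d i s).hom w) = 0) (i p : ℤ) (w : X.X i) :
    extendFunctional φ p ((X.d i p).hom w) = 0 := by
  by_cases hp : p = s
  · subst hp
    rw [extendFunctional_self, h]
  · unfold extendFunctional
    rw [dif_neg hp, LinearMap.zero_apply]

/-- The derived tensor product of two nonzero finite complexes over a local ring is nonzero, since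
the tensor product of the top cohomology modules is. -/
theorem acyclic_of_acyclic_tensorObj [IsLocalRing R] [P.IsKProjective]
    (hP : IsHomologicallyFinite P) (hP' : ¬ P.Acyclic) (hC : IsHomologicallyFinite C)
    (h : (tensorObj P C).Acyclic) : C.Acyclic := by
  by_contra hCac
  obtain ⟨s, hs, htop⟩ := hP.1.exists_top hP'
  have := hP.2 s
  obtain ⟨c, φ, hc, hφ, hφc⟩ := exists_top_functional htop hs
  obtain ⟨t, ht, htop'⟩ := hC.1.exists_top hCac
  obtain ⟨T, ι, hι, hT⟩ := exists_truncLE htop'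
  have := hC.2 t
  have hfin : Module.Finite R (T.homology t) :=
    Module.Finite.equiv (isoOfQuasiIsoAt ι t).toLinearEquiv.symm
  obtain ⟨c', φ', hφ', hφc'⟩ := exists_top_functional_of_strict hT
    (fun h => ht ((exactAt_iff_of_quasiIsoAt ι t).1 h))
  have hPT : (tensorObj P T).Acyclic :=
    have := quasiIso_tensorMap (P := P) hι
    (acyclic_iff_of_quasiIso (tensorMap P ι)).2 h
  let Φ : (tensorObj P T).X (s + t) →ₗ[R] R ⧸ IsLocalRing.maximalIdeal R :=
    tensorDesc fun p q _ => (LinearMap.mul R (R ⧸ IsLocalRing.maximalIdeal R)).compl₁₂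
      (extendFunctional φ p) (extendFunctional φ' q)
  have hΦ (p q : ℤ) (hpq : p + q = s + t) (x : P.X p) (y : T.X q) :
      Φ (tmul hpq x y) = extendFunctional φ p x * extendFunctional φ' q y :=
    tensorDesc_tmul _ hpq x y
  have hd : Φ ∘ₗ ((tensorObj P T).d (s + t - 1) (s + t)).hom = 0 := by
    refine tensor_linearMap_ext fun p q hpq x y => ?_
    rw [LinearMap.comp_apply, d_tmul hpq rfl rfl (by omega), map_add, Units.smul_def, map_zsmul,
      hΦ, hΦ, extendFunctional_d hφ, extendFunctional_d hφ', zero_mul, mul_zero, smul_zero,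
      add_zero, LinearMap.zero_apply]
  obtain ⟨w, hw⟩ := (exactAt_iff_exists (i := s + t - 1) (by omega) rfl).1 (hPT (s + t))
    (tmul rfl c c') (by
      rw [d_tmul rfl rfl rfl rfl, hc, hT _ (by omega) ((T.d t (t + 1)).hom c'), zero_tmul,
        tmul_zero, smul_zero, add_zero])
  have h1 := hΦ s t rfl c c'
  rw [← hw, extendFunctional_self, extendFunctional_self] at h1
  exact mul_ne_zero hφc hφc' (h1.symm.trans (LinearMap.congr_fun hd w))

end TensorVanishing

/-! ### Comparison maps -/

section Comparison

variable {W X X' Y P Q A : CochainComplex (ModuleCat.{u} R) ℤ}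

/-- Being a quasi-isomorphism only depends on the effect on cocycles modulo coboundaries. -/
lemma quasiIso_of_homologous {f g : X ⟶ Y}
    (h : ∀ i j : ℤ, i + 1 = j → ∀ x : X.X j, (X.d j (j + 1)).hom x = 0 →
      ∃ w : Y.X i, (f.f j).hom x = (g.f j).hom x + (Y.d i j).hom w)
    (hg : QuasiIso g) : QuasiIso f := by
  rw [quasiIso_iff_exists] at hg ⊢
  refine ⟨fun i j hij x hx ⟨v, hv⟩ => ?_, fun i j hij y hy => ?_⟩
  · obtain ⟨w, hw⟩ := h i j hij x hx
    exact hg.1 i j hij x hx ⟨v - w, by rw [map_sub, hv, hw, add_sub_cancel_right]⟩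
  · obtain ⟨x, hx, v, hv⟩ := hg.2 i j hij y hy
    obtain ⟨w, hw⟩ := h i j hij x hx
    exact ⟨x, hx, v - w, by rw [map_sub, hv, hw, add_assoc, add_sub_cancel]⟩

lemma δ_smul_comp {X Y Z : CochainComplex (ModuleCat.{u} R) ℤ} {m n : ℤ} (hm : m + 1 = n)
    (h : Cochain X Y (-1)) (z : Cochain Y Z n) (hz : δ n (n + 1) z = 0) :
    δ m n (n.negOnePow • h.comp z (show -1 + n = m by lia)) =
      (δ (-1) 0 h).comp z (zero_add n) := by
  rw [δ_units_smul, δ_comp h z _ 0 (n + 1) n hm rfl (by omega), hz, Cochain.comp_zero, zero_add,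
    smul_smul, Int.units_mul_self, one_smul]

lemma quasiIso_comp_precomp_of_homotopy {f g : X' ⟶ X} (H : Homotopy f g)
    (φ : W ⟶ homComplex X Y) (h : QuasiIso (φ ≫ homComplexPrecomp g Y)) :
    QuasiIso (φ ≫ homComplexPrecomp f Y) := by
  have hH := (Cochain.equivHomotopy _ _ H).2
  set k := (Cochain.equivHomotopy _ _ H).1
  refine quasiIso_of_homologous (fun i j hij x hx => ?_) h
  let z : Cochain X Y j := (φ.f j).hom x
  have hz : δ j (j + 1) z = 0 :=
    (f_d_apply φ j (j + 1) x).symm.trans ((congrArg (φ.f (j + 1)).hom hx).trans (map_zero _))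
  refine ⟨j.negOnePow • k.comp z (show -1 + j = i by omega), ?_⟩
  change (Cochain.ofHom f).comp z (zero_add j) = (Cochain.ofHom g).comp z (zero_add j) +
    δ i j (j.negOnePow • k.comp z _)
  rw [δ_smul_comp hij k z hz, hH, Cochain.add_comp, add_comm]

lemma quasiIso_of_two_of_six {f : W ⟶ X} {g : X ⟶ Y} {h : Y ⟶ P} (hfg : QuasiIso (f ≫ g))
    (hgh : QuasiIso (g ≫ h)) : QuasiIso f := by
  have hg : QuasiIso g := by
    rw [quasiIso_iff] at hfg hgh ⊢
    intro i
    have h1 := hfg i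
    have h2 := hgh i
    rw [quasiIsoAt_iff_isIso_homologyMap, homologyMap_comp] at h1 h2
    rw [quasiIsoAt_iff_isIso_homologyMap]
    have : Mono (homologyMap g i) := mono_of_mono_fac (rfl : _ = homologyMap g i ≫ homologyMap h i)
    have : IsSplitEpi (homologyMap g i) :=
      ⟨⟨⟨inv (homologyMap f i ≫ homologyMap g i) ≫ homologyMap f i, by simp⟩⟩⟩
    exact isIso_of_mono_of_isSplitEpi _
  exact quasiIso_of_comp_right f g

lemma homComplexPrecomp_comp (f : X' ⟶ X) (g : X ⟶ P) :
    homComplexPrecomp g Y ≫ homComplexPrecomp f Y = homComplexPrecomp (f ≫ g) Y := by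
  ext n : 1
  refine ModuleCat.hom_ext (LinearMap.ext fun (z : Cochain P Y n) => ?_)
  change (Cochain.ofHom f).comp ((Cochain.ofHom g).comp z (zero_add n)) (zero_add n) =
    (Cochain.ofHom (f ≫ g)).comp z (zero_add n)
  rw [Cochain.ofHom_comp, Cochain.comp_assoc_of_first_is_zero_cochain]

lemma homothety_comp_evalRingOne (f : ringComplex R ⟶ Y) : homothety f ≫ evalRingOne Y = f := by
  refine ringComplex_hom_ext ((congrArg ((evalRingOne Y).f 0).hom (homothety_ringOne f)).trans ?_)
  rw [evalRingOne_apply, evalAt_ofHom]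

lemma quasiIso_homothety_iff [P.IsKProjective] {f : P ⟶ X} (hf : QuasiIso f) :
    QuasiIso (homothety f) ↔ QuasiIso (homothety (𝟙 P)) := by
  have := quasiIso_homComplexPostcomp (P := P) hf
  have h : homothety f = homothety (𝟙 P) ≫ homComplexPostcomp P f := by
    rw [homothety_comp_postcomp, Category.id_comp]
  rw [h]
  exact quasiIso_iff_comp_right _ _

lemma evalAt_biduality {n p q : ℤ} (x : P.X n) (hpq : p + n = q) (f : Cochain P A p) :
    evalAt (X := homComplex P A) (((biduality P A).f n).hom x) p q hpq f =
      (n * p).negOnePow • evalAt f n q (by lia) x := rfl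

lemma evalAt_ofHom_comp (f : X' ⟶ X) {n : ℤ} (z : Cochain X Y n) (p q : ℤ) (hpq : p + n = q)
    (x : X'.X p) : evalAt ((Cochain.ofHom f).comp z (zero_add n)) p q hpq x =
      evalAt z p q hpq ((f.f p).hom x) := by
  rw [evalAt_comp _ _ _ p p q (add_zero p) hpq, evalAt_ofHom]

/-- The map `P ⟶ Hom(R, A)` corresponding to the homothety of `π : P ⟶ A` is `π` itself. -/
lemma biduality_comp_precomp_homothety (π : P ⟶ A) :
    biduality P A ≫ homComplexPrecomp (homothety π) A ≫ evalRingOne A = π := by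
  ext n : 1
  refine ModuleCat.hom_ext (LinearMap.ext fun x => ?_)
  refine (evalAt_ofHom_comp (homothety π) (show Cochain (homComplex P A) A n from
    ((biduality P A).f n).hom x) 0 n (zero_add n) (ringOne R)).trans ?_
  refine (evalAt_biduality x (zero_add n) _).trans ?_
  rw [homothety_ringOne, evalAt_ofHom, mul_zero, Int.negOnePow_zero, one_smul]

/-- The triangle identity for the self-adjoint functor `Hom(-, A)`. -/
lemma biduality_comp_precomp_biduality (f : Q ⟶ homComplex P A) :
    biduality Q A ≫ homComplexPrecomp (biduality P A ≫ homComplexPrecomp f A) A = f := by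
  ext n : 1
  refine ModuleCat.hom_ext (LinearMap.ext fun y => ?_)
  refine cochain_ext fun p q hpq x => ?_
  refine (evalAt_ofHom_comp (biduality P A ≫ homComplexPrecomp f A)
    (show Cochain (homComplex Q A) A n from ((biduality Q A).f n).hom y) p q hpq x).trans ?_
  refine (evalAt_biduality y hpq _).trans ?_
  refine (congrArg ((n * p).negOnePow • ·) (evalAt_ofHom_comp f
    (show Cochain (homComplex P A) A p from ((biduality P A).f p).hom x) n q (by omega) y)).trans ?_
  refine (congrArg ((n * p).negOnePow • ·) (evalAt_biduality x (by omega) _)).trans ?_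
  rw [smul_smul, mul_comm p n, Int.units_mul_self, one_smul]

/-- For `π : Q ⟶ Hom(P, A)`, the map `Hom(P, P) ⟶ Hom(Q, Hom(P, A))` sending `f` to
`x ↦ (-1) ^ (|f| |x|) π(x) ∘ f`. -/
def endAction (π : Q ⟶ homComplex P A) : homComplex P P ⟶ homComplex Q (homComplex P A) where
  f n := ModuleCat.ofHom
    { toFun := fun (f : Cochain P P n) => Cochain.mk fun p q (hpq : p + n = q) => ModuleCat.ofHom
        { toFun := fun x => (n * p).negOnePow •
            f.comp (show Cochain P A p from (π.f p).hom x) (show n + p = q by lia)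
          map_add' := fun x y => by
            rw [map_add, ← smul_add]
            exact congrArg ((n * p).negOnePow • ·) (Cochain.comp_add _ _ _ _)
          map_smul' := fun r x => by
            rw [map_smul]
            refine (congrArg ((n * p).negOnePow • ·) (Cochain.comp_smul _ _ _ _)).trans ?_
            exact smul_comm _ _ (show Cochain P A q from _) }
      map_add' := fun f g => Cochain.ext _ _ fun p q hpq => ModuleCat.hom_ext <|
        LinearMap.ext fun x => by
          refine (congrArg ((n * p).negOnePow • ·) (Cochain.add_comp f g _ _)).trans ?_
          exact smul_add _ _ _
      map_smul' := fun r f => Cochain.ext _ _ fun p q hpq => ModuleCat.hom_ext <|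
        LinearMap.ext fun x => by
          refine (congrArg ((n * p).negOnePow • ·) (Cochain.smul_comp r f _ _)).trans ?_
          exact smul_comm _ _ (show Cochain P A q from _) }
  comm' n m hnm := by
    obtain rfl : n + 1 = m := hnm
    refine ModuleCat.hom_ext (LinearMap.ext fun (f : Cochain P P n) => ?_)
    refine cochain_ext (X := Q) (Y := homComplex P A) fun p q hpq x => ?_
    obtain rfl : q = p + n + 1 := by lia
    refine (evalAt_δ (Y := homComplex P A) rfl _ p (p + 1) (p + n) (p + n + 1) rfl rfl hpq x).trans
      ?_
    let z : Cochain P A p := (π.f p).hom x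
    have hz : (π.f (p + 1)).hom ((Q.d p (p + 1)).hom x) = δ p (p + 1) z := f_d_apply π p (p + 1) x
    change δ (p + n) (p + n + 1) ((n * p).negOnePow • f.comp z _) +
      (n + 1).negOnePow • ((n * (p + 1)).negOnePow •
        f.comp (show Cochain P A (p + 1) from (π.f (p + 1)).hom ((Q.d p (p + 1)).hom x)) _) =
      ((n + 1) * p).negOnePow • (δ n (n + 1) f).comp z _
    rw [hz, δ_units_smul, δ_comp f z _ (n + 1) (p + 1) (p + n + 1) rfl rfl rfl]
    have e1 : (n + 1).negOnePow * (n * (p + 1)).negOnePow = - (n * p).negOnePow := by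
      rw [← Int.negOnePow_add, ← Int.negOnePow_succ, Int.negOnePow_eq_iff]
      exact ⟨n, by ring⟩
    have e2 : (n * p).negOnePow * p.negOnePow = ((n + 1) * p).negOnePow := by
      rw [← Int.negOnePow_add, add_one_mul]
    rw [smul_smul, e1, smul_add, smul_smul, e2, Units.neg_smul]
    abel

lemma evalAt_endAction (π : Q ⟶ homComplex P A) {n p q : ℤ} (f : Cochain P P n) (hpq : p + n = q)
    (x : Q.X p) :
    evalAt (Y := homComplex P A) (((endAction π).f n).hom f) p q hpq x =
      (n * p).negOnePow • f.comp (show Cochain P A p from (π.f p).hom x) (by lia) := rfl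

lemma homothety_comp_endAction (π : Q ⟶ homComplex P A) :
    homothety (𝟙 P) ≫ endAction π = homothety π := by
  refine ringComplex_hom_ext ?_
  rw [homothety_ringOne]
  refine (congrArg ((endAction π).f 0).hom (homothety_ringOne (𝟙 P))).trans ?_
  refine cochain_ext (X := Q) (Y := homComplex P A) fun p q hpq x => ?_
  obtain rfl : p = q := by omega
  rw [evalAt_endAction, evalAt_ofHom, zero_mul, Int.negOnePow_zero, one_smul, Cochain.id_comp]

end Comparison

/-! ### The equivalent conditions -/

section Equivalences

variable {A : CochainComplex (ModuleCat.{u} R) ℤ}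

lemma isHomologicallyFinite_ringComplex [IsNoetherianRing R] :
    IsHomologicallyFinite (ringComplex R) := by
  have h (j : ℤ) (hj : j ≠ 0) : (ringComplex R).ExactAt j :=
    exactAt_of_forall_eq_zero (ringComplex_eq_zero hj)
  refine ⟨(Set.finite_singleton 0).subset fun j hj => by_contra fun hj' => hj (h j hj'),
    fun j => ?_⟩
  by_cases hj : j = 0
  · subst hj
    have : Module.Finite R ((ringComplex R).X 0) := Module.Finite.equiv
      (singleObjXSelf (ComplexShape.up ℤ) 0 (ModuleCat.of R R)).toLinearEquiv.symm
    exact finite_homology_of_finite 0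
  · have := (exactAt_iff_subsingleton_homology j).1 (h j hj)
    infer_instance

lemma not_acyclic_ringComplex [Nontrivial R] : ¬ (ringComplex R).Acyclic := by
  intro h
  obtain ⟨w, hw⟩ := (exactAt_iff_exists (i := -1) (by omega) rfl).1 (h 0) (ringOne R)
    (ringComplex_d _ _ _)
  rw [ringComplex_d] at hw
  exact one_ne_zero (smul_ringOne_eq_zero (r := (1 : R)) (by rw [one_smul, ← hw]))

/-- The resolution of `RHom(A, A)` by the ring, when the homothety is a quasi-isomorphism. -/
def KProjRes.ofHomothety (p : KProjRes A) (h : QuasiIso (homothety p.π)) :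
    KProjRes (RHom p A) where
  P := ringComplex R
  π := homothety p.π
  isKProjective := isKProjective_ringComplex
  quasiIso := h

lemma quasiIso_biduality_comp_precomp_homothety (p : KProjRes A) :
    QuasiIso (biduality p.P A ≫ homComplexPrecomp (homothety p.π) A) := by
  have := quasiIso_evalRingOne (Y := A)
  have := p.quasiIso
  have h : QuasiIso ((biduality p.P A ≫ homComplexPrecomp (homothety p.π) A) ≫ evalRingOne A) := by
    rwa [Category.assoc, biduality_comp_precomp_homothety]
  exact quasiIso_of_comp_right _ (evalRingOne A)

lemma IsSemidualizing.not_acyclic [Nontrivial R] (h : IsSemidualizing A) : ¬ A.Acyclic := by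
  obtain ⟨-, p, hp⟩ := h
  have := p.isKProjective
  exact fun hac => not_acyclic_ringComplex (R := R)
    ((acyclic_iff_of_quasiIso (homothety p.π)).2 (acyclic_homComplex hac))

lemma isHomologicallyFinite_RHom [IsNoetherianRing R] {p : KProjRes A}
    (h : QuasiIso (homothety p.π)) : IsHomologicallyFinite (RHom p A) :=
  (IsHomologicallyFinite.of_quasiIso (homothety p.π)).1 isHomologicallyFinite_ringComplex

lemma IsSemidualizing.isSemidualizing_RHom [IsNoetherianRing R] (h : IsSemidualizing A) :
    ∃ p : KProjRes A, IsSemidualizing (RHom p A) := by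
  obtain ⟨-, p, hp⟩ := h
  refine ⟨p, isHomologicallyFinite_RHom hp, p.ofHomothety hp, ?_⟩
  have := quasiIso_evalRingOne (Y := RHom p A)
  have : QuasiIso (homothety (homothety p.π) ≫ evalRingOne (RHom p A)) := by
    rwa [homothety_comp_evalRingOne]
  exact (quasiIso_of_comp_right (homothety (homothety p.π)) (evalRingOne (RHom p A)) :)

/-- The homothety of `P` is the first of three composable maps `R ⟶ Hom(P, P) ⟶ Hom(Q, E) ⟶ E`,
where `Q` is a resolution of `E = Hom(P, A)`. The composite of the first two is the homothety of
`Q ⟶ E`, and the composite of the last two agrees on cohomology with composition with `P ⟶ A`. -/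
lemma isSemidualizing_of_RHom (hA : IsHomologicallyFinite A) (p : KProjRes A)
    (h : IsSemidualizing (RHom p A)) : IsSemidualizing A := by
  obtain ⟨-, q, hq⟩ := h
  have := p.isKProjective
  refine ⟨hA, p, (quasiIso_homothety_iff p.quasiIso).2 ?_⟩
  rw [← homothety_comp_endAction] at hq
  have := isKProjective_ringComplex (R := R)
  obtain ⟨χ, ⟨H⟩⟩ := exists_homotopy_lift (P := ringComplex R) q.quasiIso (homothety p.π)
  -- The second composite sends a cocycle `f` to `π ∘ f` up to a coboundary.
  refine quasiIso_of_two_of_six (h := homComplexPrecomp χ (RHom p A) ≫ evalRingOne (RHom p A)) hq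
    (quasiIso_of_homologous (g := homComplexPostcomp p.P p.π) ?_
      (quasiIso_homComplexPostcomp p.quasiIso))
  have hH := (Cochain.equivHomotopy _ _ H).2
  set k := (Cochain.equivHomotopy _ _ H).1
  let w : Cochain p.P A (-1) := evalAt (Y := RHom p A) k 0 (-1) (by omega) (ringOne R)
  let z : Cochain p.P A 0 := (q.π.f 0).hom ((χ.f 0).hom (ringOne R))
  have hw : z = δ (-1) 0 w + Cochain.ofHom p.π := by
    have h1 := congrArg (fun u => evalAt (Y := RHom p A) u 0 0 (add_zero 0) (ringOne R)) hH
    beta_reduce at h1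
    rw [evalAt_add, evalAt_δ_of_d_eq_zero (by omega) k (q := -1) (by omega) (by omega)
      (ringComplex_d _ _ _), evalAt_ofHom, evalAt_ofHom, homothety_ringOne] at h1
    exact h1
  rintro i j hij (f : Cochain p.P p.P j) hf
  replace hf : δ j (j + 1) f = 0 := hf
  refine ⟨f.comp w (by omega), ?_⟩
  change evalAt (Y := RHom p A) ((Cochain.ofHom χ).comp (show Cochain q.P (RHom p A) j from
    ((endAction q.π).f j).hom f) (zero_add j)) 0 j (zero_add j) (ringOne R) =
      f.comp (Cochain.ofHom p.π) (add_zero j) + δ i j (f.comp w _)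
  rw [evalAt_ofHom_comp]
  refine (evalAt_endAction q.π f (zero_add j) _).trans ?_
  rw [mul_zero, Int.negOnePow_zero, one_smul, δ_comp f w _ (j + 1) 0 j hij rfl (by omega), hf,
    Cochain.zero_comp, smul_zero, add_zero, ← Cochain.comp_add, add_comm]
  exact congrArg (fun u => f.comp u (add_zero j)) hw

lemma IsSemidualizing.isDerivedReflexive [IsNoetherianRing R] (h : IsSemidualizing A) :
    IsDerivedReflexive A A := by
  obtain ⟨hA, p, hp⟩ := h
  exact ⟨hA, p, isHomologicallyFinite_RHom hp, p.ofHomothety hp,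
    quasiIso_biduality_comp_precomp_homothety p⟩

lemma IsSemidualizing.isDerivedReflexive_RHom [IsNoetherianRing R] (h : IsSemidualizing A) :
    ∃ p : KProjRes A, IsDerivedReflexive A (RHom p A) := by
  obtain ⟨hA, p, hp⟩ := h
  have := quasiIso_evalRingOne (Y := A)
  refine ⟨p, isHomologicallyFinite_RHom hp, p.ofHomothety hp,
    (IsHomologicallyFinite.of_quasiIso (evalRingOne A)).2 hA,
    ⟨p.P, _, p.isKProjective, quasiIso_biduality_comp_precomp_homothety p⟩, ?_⟩
  refine (biduality_comp_precomp_biduality (homothety p.π)).symm ▸ hp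

/-- Morphisms of finite complexes are detected by their duals with respect to a nonzero finite
complex. -/
lemma quasiIso_of_quasiIso_precomp [IsNoetherianRing R] [IsLocalRing R]
    {P Q : CochainComplex (ModuleCat.{u} R) ℤ} [P.IsKProjective] [Q.IsKProjective] (f : P ⟶ Q)
    (hP : IsHomologicallyFinite P) (hQ : IsHomologicallyFinite Q) (hA : IsHomologicallyFinite A)
    (hA' : ¬ A.Acyclic) (hf : QuasiIso (homComplexPrecomp f A)) : QuasiIso f := by
  have := isKProjective_mappingCone (f := f) inferInstance inferInstance
  exact quasiIso_iff_acyclic_mappingCone.2 (acyclic_of_acyclic_homComplex (hP.mappingCone hQ) hA hA'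
    (acyclic_homComplex_mappingCone hf))

/-- A map `g : P ⟶ F` from a K-projective complex is a quasi-isomorphism if its dual, formed with a
K-projective resolution of `F`, becomes one after composition with a quasi-isomorphism. -/
lemma quasiIso_of_quasiIso_comp_precomp [IsNoetherianRing R] [IsLocalRing R]
    {P F W : CochainComplex (ModuleCat.{u} R) ℤ} [P.IsKProjective] (q : KProjRes F) (g : P ⟶ F)
    (hP : IsHomologicallyFinite P) (hF : IsHomologicallyFinite F) (hA : IsHomologicallyFinite A)
    (hA' : ¬ A.Acyclic) (φ : W ⟶ homComplex F A) (hq : QuasiIso (φ ≫ homComplexPrecomp q.π A))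
    (hg : QuasiIso (φ ≫ homComplexPrecomp g A)) : QuasiIso g := by
  have := q.isKProjective
  have := q.quasiIso
  obtain ⟨g', ⟨H⟩⟩ := exists_homotopy_lift q.quasiIso g
  have h1 := quasiIso_comp_precomp_of_homotopy H φ hg
  rw [← homComplexPrecomp_comp, ← Category.assoc] at h1
  have := quasiIso_of_quasiIso_precomp g' hP ((IsHomologicallyFinite.of_quasiIso q.π).2 hF) hA hA'
    (quasiIso_of_comp_left (φ ≫ homComplexPrecomp q.π A) _)
  exact quasiIso_of_homotopy H inferInstance

lemma IsDerivedReflexive.isSemidualizing [IsNoetherianRing R] [IsLocalRing R]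
    (h : IsDerivedReflexive A A) (hA' : ¬ A.Acyclic) : IsSemidualizing A := by
  obtain ⟨hA, p, hE, q, hq⟩ := h
  have := isKProjective_ringComplex (R := R)
  exact ⟨hA, p, quasiIso_of_quasiIso_comp_precomp q (homothety p.π)
    isHomologicallyFinite_ringComplex hE hA hA' (biduality p.P A) hq
    (quasiIso_biduality_comp_precomp_homothety p)⟩

lemma isDerivedReflexive_of_RHom [IsNoetherianRing R] [IsLocalRing R]
    (hA : IsHomologicallyFinite A) (hA' : ¬ A.Acyclic) (p : KProjRes A)
    (h : IsDerivedReflexive A (RHom p A)) : IsDerivedReflexive A A := by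
  obtain ⟨hE, p', hF, q, hq⟩ := h
  have := p.isKProjective
  have := p.quasiIso
  refine ⟨hA, p, hE, p', quasiIso_of_quasiIso_comp_precomp q _
    ((IsHomologicallyFinite.of_quasiIso p.π).2 hA) hF hA hA' (biduality p'.P A) hq ?_⟩
  rw [biduality_comp_precomp_biduality]
  exact p'.quasiIso

lemma IsSemidualizing.inBassClass [IsNoetherianRing R] (h : IsSemidualizing A) :
    InBassClass A A := by
  obtain ⟨hA, p, hp⟩ := h
  have := p.isKProjective
  refine ⟨hA.1, p, (isHomologicallyFinite_RHom hp).1, ?_⟩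
  have := quasiIso_tensorUnit (P := p.P)
  have := quasiIso_tensorMap (P := p.P) hp
  have : QuasiIso ((tensorUnit p.P ≫ tensorMap p.P (homothety p.π)) ≫ evaluation p.P A) := by
    rw [Category.assoc, tensorUnit_comp_evaluation]
    exact p.quasiIso
  exact quasiIso_of_comp_left (tensorUnit p.P ≫ tensorMap p.P (homothety p.π)) _

lemma InBassClass.isSemidualizing [IsNoetherianRing R] [IsLocalRing R]
    (hA : IsHomologicallyFinite A) (hA' : ¬ A.Acyclic) (h : InBassClass A A) :
    IsSemidualizing A := by
  obtain ⟨-, p, hE, hev⟩ := h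
  have := p.isKProjective
  have := p.quasiIso
  refine ⟨hA, p, ?_⟩
  have := quasiIso_tensorUnit (P := p.P)
  have : QuasiIso ((tensorUnit p.P ≫ tensorMap p.P (homothety p.π)) ≫ evaluation p.P A) := by
    rw [Category.assoc, tensorUnit_comp_evaluation]
    exact p.quasiIso
  have : QuasiIso (tensorUnit p.P ≫ tensorMap p.P (homothety p.π)) :=
    quasiIso_of_comp_right _ (evaluation p.P A)
  have hP := (IsHomologicallyFinite.of_quasiIso p.π).2 hA
  exact quasiIso_iff_acyclic_mappingCone.2 (acyclic_of_acyclic_tensorObj hP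
    (fun h => hA' ((acyclic_iff_of_quasiIso p.π).1 h))
    (isHomologicallyFinite_ringComplex.mappingCone ⟨hE, finite_homology_homComplex hP hA⟩)
    (acyclic_tensorObj_mappingCone (quasiIso_of_comp_left (tensorUnit p.P) _)))

lemma isSemidualizing_iff_inAuslanderClass [IsNoetherianRing R] (hA : IsHomologicallyFinite A) :
    IsSemidualizing A ↔ InAuslanderClass A (ringComplex R) := by
  have key (p : KProjRes A) : IsHomologicallyBounded (LTensor p (ringComplex R)) ∧
      (QuasiIso (homothety p.π) ↔ QuasiIso (coevaluation p.P (ringComplex R))) := by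
    have := p.isKProjective
    have := p.quasiIso
    have := quasiIso_tensorUnit (P := p.P)
    rw [coevaluation_ringComplex, quasiIso_homothety_iff p.quasiIso,
      quasiIso_homothety_iff quasiIso_tensorUnit]
    exact ⟨(IsHomologicallyBounded.of_quasiIso (tensorUnit p.P)).1
      ((IsHomologicallyBounded.of_quasiIso p.π).2 hA.1), Iff.rfl⟩
  exact ⟨fun ⟨_, p, hp⟩ => ⟨isHomologicallyFinite_ringComplex.1, p, (key p).1, (key p).2.1 hp⟩,
    fun ⟨_, p, _, hp⟩ => ⟨hA, p, (key p).2.2 hp⟩⟩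

end Equivalences

end DerivedMod


end

open DerivedMod
theorem theorem3p1 {R : Type u} [CommRing R] [IsNoetherianRing R] [IsLocalRing R]
    (A : CochainComplex (ModuleCat.{u} R) ℤ) (hA : IsHomologicallyFinite A) :
    List.TFAE
      [IsSemidualizing A,
        ∃ p : KProjRes A, IsSemidualizing (RHom p A),
        IsDerivedReflexive A A ∧ ¬ A.Acyclic,
        (∃ p : KProjRes A, IsDerivedReflexive A (RHom p A)) ∧ ¬ A.Acyclic,
        InBassClass A A ∧ ¬ A.Acyclic,
        InAuslanderClass A (ringComplex R)] := by
  tfae_have 1 → 2 := fun h => h.isSemidualizing_RHom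
  tfae_have 2 → 1 := fun ⟨p, hp⟩ => isSemidualizing_of_RHom hA p hp
  tfae_have 1 → 3 := fun h => ⟨h.isDerivedReflexive, h.not_acyclic⟩
  tfae_have 3 → 1 := fun ⟨h, h'⟩ => h.isSemidualizing h'
  tfae_have 1 → 4 := fun h => ⟨h.isDerivedReflexive_RHom, h.not_acyclic⟩
  tfae_have 4 → 3 := fun ⟨⟨p, h⟩, h'⟩ => ⟨isDerivedReflexive_of_RHom hA h' p h, h'⟩
  tfae_have 1 → 5 := fun h => ⟨h.inBassClass, h.not_acyclic⟩
  tfae_have 5 → 1 := fun ⟨h, h'⟩ => h.isSemidualizing hA h'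
  tfae_have 1 ↔ 6 := isSemidualizing_iff_inAuslanderClass hA
  tfae_finish
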